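/- Let $N\ge 2$. A set $S\subset\mathbb{C}^N$ is a $C^\infty$ hypersurface if it is an embedded $C^\infty$ submanifold of real codimension $1$ (not necessarily closed in $\mathbb C^N$). It is Levi-flat if the bundle $T^cS$, with fibres $T^c_pS=J(T_pS)\cap T_pS$ where $J$ is the complex structure of $\mathbb{C}^N$, is involutive. A set $H\subset\mathbb{C}^N$ is a $C^\infty$ hypersurface with boundary $\partial H\subset H$ if $H\setminus\partial H$ is a $C^\infty$ hypersurface and every $p\in\partial H$ has an open neighbourhood $U\subset\mathbb{C}^N$ with a $C^\infty$ diffeomorphism $\varphi\colon U\to\mathbb{R}^{2N}$ such that $\varphi(H\cap U)=\{x: x_{2N-1}\ge 0,\ x_{2N}=0\}$ and $\varphi(\partial H\cap U)=\{x: x_{2N-1}=0,\ x_{2N}=0\}$; it is called Levi-flat if $H\setminus\partial H$ is Levi-flat. Regard $\mathbb{C}^{N-2}\times\mathbb{R}^2$ as the set of points of $\mathbb{C}^N$ whose last two coordinates are real. Theorem. Suppose $H\subset\mathbb{C}^N$ is a $C^\infty$ Levi-flat hypersurface with boundary, and $0\in\partial H\subset\mathbb{C}^{N-2}\times\mathbb{R}^2$.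 Then for some neighbourhood $U$ of the origin there exists a $C^\infty$ Levi-flat hypersurface $\mathcal{H}\subset\mathbb{C}^N$ (without boundary) such that $H\cap U\subset\mathcal{H}$. Further, the germ $(\mathcal{H},0)$ is unique: if $\mathcal{H}'\subset\mathbb C^N$ is a $C^\infty$ Levi-flat hypersurface such that $H\cap V\subset\mathcal{H}'$ for some neighbourhood $V$ of $0$, then $\mathcal{H}'\cap W=\mathcal{H}\cap W$ for some neighbourhood $W$ of $0$. -/

import Mathlib

open scoped ContDiff Topology

/-- `φ` is a `C^∞` diffeomorphism from an open subset of `ℂ^N` onto an open subset of `ℝ^{2N}`. -/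
def IsSmoothChart {N : ℕ} (φ : OpenPartialHomeomorph (Fin N → ℂ) (Fin (2 * N) → ℝ)) : Prop :=
  ContDiffOn ℝ ∞ φ φ.source ∧ ContDiffOn ℝ ∞ φ.symm φ.target

/-- `{x ∈ ℝ^{2N} | x_{2N} = 0}` (coordinates are indexed from `0` in `Fin (2 * N)`). -/
def modelHyperplane (N : ℕ) : Set (Fin (2 * N) → ℝ) :=
  {x | ∀ i : Fin (2 * N), (i : ℕ) + 1 = 2 * N → x i = 0}

/-- `{x ∈ ℝ^{2N} | x_{2N-1} ≥ 0, x_{2N} = 0}`. -/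
def modelHalf (N : ℕ) : Set (Fin (2 * N) → ℝ) :=
  {x | (∀ i : Fin (2 * N), (i : ℕ) + 2 = 2 * N → 0 ≤ x i) ∧
    ∀ i : Fin (2 * N), (i : ℕ) + 1 = 2 * N → x i = 0}

/-- `{x ∈ ℝ^{2N} | x_{2N-1} = 0, x_{2N} = 0}`. -/
def modelEdge (N : ℕ) : Set (Fin (2 * N) → ℝ) :=
  {x | (∀ i : Fin (2 * N), (i : ℕ) + 2 = 2 * N → x i = 0) ∧
    ∀ i : Fin (2 * N), (i : ℕ) + 1 = 2 * N → x i = 0}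

/-- `S` is a `C^∞` hypersurface of `ℂ^N` (without boundary): an embedded `C^∞` submanifold of
real codimension one. It need not be closed in `ℂ^N`. -/
def IsSmoothHypersurface {N : ℕ} (S : Set (Fin N → ℂ)) : Prop :=
  ∀ p ∈ S, ∃ φ : OpenPartialHomeomorph (Fin N → ℂ) (Fin (2 * N) → ℝ),
    p ∈ φ.source ∧ IsSmoothChart φ ∧ φ '' (S ∩ φ.source) = φ.target ∩ modelHyperplane N

/-- `H` is a `C^∞` hypersurface with boundary in `ℂ^N`, whose boundary is `bH`. -/
structure IsSmoothHypersurfaceWithBoundary {N : ℕ} (H bH : Set (Fin N → ℂ)) : Prop where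
  boundary_subset : bH ⊆ H
  interior_hypersurface : IsSmoothHypersurface (H \ bH)
  boundary_chart : ∀ p ∈ bH, ∃ φ : OpenPartialHomeomorph (Fin N → ℂ) (Fin (2 * N) → ℝ),
    p ∈ φ.source ∧ IsSmoothChart φ ∧ φ.target = Set.univ ∧
      φ '' (H ∩ φ.source) = modelHalf N ∧ φ '' (bH ∩ φ.source) = modelEdge N

/-- The real tangent space `T_p S`: velocities at `p` of curves in `S`. -/
def realTangent {N : ℕ} (S : Set (Fin N → ℂ)) (p : Fin N → ℂ) : Set (Fin N → ℂ) :=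
  {v | ∃ γ : ℝ → Fin N → ℂ, γ 0 = p ∧ HasDerivAt γ v 0 ∧ ∀ᶠ t in 𝓝 (0 : ℝ), γ t ∈ S}

/-- The complex tangent space `T^c_p S = J (T_p S) ∩ T_p S`, `J` being multiplication by `i`. -/
def complexTangent {N : ℕ} (S : Set (Fin N → ℂ)) (p : Fin N → ℂ) : Set (Fin N → ℂ) :=
  ((fun v : Fin N → ℂ => Complex.I • v) '' realTangent S p) ∩ realTangent S p

/-- Levi-flatness of a hypersurface `S`: the bundle `T^c S` is involutive, that is, the Lie bracket
of two local `C^∞` sections of `T^c S` is a section of `T^c S`. Local sections are given by `C^∞`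
vector fields on open subsets of `ℂ^N` whose values along `S` lie in `T^c S`; along `S` the bracket
depends only on the restrictions of the fields to `S`. -/
def IsLeviFlat {N : ℕ} (S : Set (Fin N → ℂ)) : Prop :=
  ∀ (U : Set (Fin N → ℂ)) (X Y : (Fin N → ℂ) → (Fin N → ℂ)), IsOpen U →
    ContDiffOn ℝ ∞ X U → ContDiffOn ℝ ∞ Y U →
    (∀ p ∈ S ∩ U, X p ∈ complexTangent S p) → (∀ p ∈ S ∩ U, Y p ∈ complexTangent S p) →
    ∀ p ∈ S ∩ U, VectorField.lieBracket ℝ X Y p ∈ complexTangent S p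

/-- `ℂ^{N-2} × ℝ²` inside `ℂ^N`: the last two coordinates are real. -/
def flatModel (N : ℕ) : Set (Fin N → ℂ) :=
  {p | ∀ i : Fin N, N ≤ (i : ℕ) + 2 → (p i).im = 0}

/-! Near the origin, `H` is a half-graph `Im p_k = r p`, `σ Im p_j ≥ 0`, where `j` and `k` are the
last two indices in some order, `σ = ±1`, and `r = 0` on the edge `Im p_j = 0` because `∂H` is real
in these coordinates. A graph is Levi-flat exactly when the bracket coefficient of its complex
tangent fields vanishes; along the complex `j`-direction this says that its slope `b` is annihilated
by the tangential Cauchy–Riemann operator `L_b`, while `L_b r = i b̄`.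

Existence. The conjugate reflection `p ↦ -r (p̄)` gives a Levi-flat half-graph on the other side of
the edge. On the edge the slope `b` is real, and by Levi-flatness constant along the imaginary
directions, so it agrees with that of the reflection. The two equations then determine all normal
derivatives along the edge, so both half-graphs agree there to infinite order and glue to a smooth
Levi-flat graph.

Uniqueness. For two Levi-flat extensions, first the difference of the slopes and then that of the
heights satisfies `‖L_b f‖ ≤ C ‖f‖` and vanishes on one side of the edge. The edge is
noncharacteristic for `L_b`, which commutes with its conjugate because `L_b b = 0`, so a Carleman
estimate with a weight that is convex along `L_b` yields `f = 0` near the origin. -/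

open Filter

section DirectionalDerivative

variable {E G G' : Type*} [NormedAddCommGroup E] [NormedSpace ℝ E]
  [NormedAddCommGroup G] [NormedSpace ℝ G] [NormedAddCommGroup G'] [NormedSpace ℝ G']

/-- The derivative `∂_v f` of `f` in the constant direction `v`, as a function of the base point. -/
noncomputable def dirDeriv (v : E) (f : E → G) : E → G := fun p => fderiv ℝ f p v

theorem differentiableAt_of_smooth {f : E → G} (hf : ContDiff ℝ ∞ f) (p : E) :
    DifferentiableAt ℝ f p :=
  hf.contDiffAt.differentiableAt (by simp)

theorem contDiff_dirDeriv {f : E → G} (hf : ContDiff ℝ ∞ f) (v : E) :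
    ContDiff ℝ ∞ (dirDeriv v f) :=
  (hf.fderiv_right (m := ∞) (by simp)).clm_apply contDiff_const

theorem hasCompactSupport_dirDeriv {f : E → G} (hf : HasCompactSupport f) (v : E) :
    HasCompactSupport (dirDeriv v f) :=
  hf.fderiv_apply (𝕜 := ℝ) v

theorem dirDeriv_congr {f g : E → G} {p : E} (h : f =ᶠ[𝓝 p] g) (v : E) :
    dirDeriv v f p = dirDeriv v g p := by
  simp only [dirDeriv, h.fderiv_eq]

theorem dirDeriv_add_smul_dir (f : E → G) (u v : E) (c : ℝ) :
    dirDeriv (u + c • v) f = dirDeriv u f + c • dirDeriv v f := by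
  funext p
  simp [dirDeriv]

theorem dirDeriv_comm {f : E → G} (hf : ContDiff ℝ ∞ f) (u v : E) :
    dirDeriv u (dirDeriv v f) = dirDeriv v (dirDeriv u f) := by
  funext p
  have hd : DifferentiableAt ℝ (fderiv ℝ f) p :=
    differentiableAt_of_smooth (hf.fderiv_right (m := ∞) (by simp)) p
  have second (a b : E) : dirDeriv a (dirDeriv b f) p = fderiv ℝ (fderiv ℝ f) p a b :=
    congrArg (· a) (hd.hasFDerivAt.clm_apply (hasFDerivAt_const b p)).fderiv |>.trans (by simp)
  rw [second, second]
  exact second_derivative_symmetric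
    (fun q => (differentiableAt_of_smooth hf q).hasFDerivAt) hd.hasFDerivAt u v

theorem dirDeriv_add {f g : E → G} (hf : ContDiff ℝ ∞ f) (hg : ContDiff ℝ ∞ g) (v : E) :
    dirDeriv v (f + g) = dirDeriv v f + dirDeriv v g := by
  funext p
  simp [dirDeriv, fderiv_add (differentiableAt_of_smooth hf p) (differentiableAt_of_smooth hg p)]

theorem dirDeriv_sum {ι : Type*} {s : Finset ι} {f : ι → E → G}
    (hf : ∀ i, ContDiff ℝ ∞ (f i)) (v : E) :
    dirDeriv v (∑ i ∈ s, f i) = ∑ i ∈ s, dirDeriv v (f i) := by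
  funext p
  simp [dirDeriv, fderiv_sum fun i _ => differentiableAt_of_smooth (hf i) p]

theorem dirDeriv_smul {f : E → G} (c : ℝ) (v : E) :
    dirDeriv v (c • f) = c • dirDeriv v f := by
  funext p
  simp [dirDeriv, fderiv_const_smul_field]

theorem dirDeriv_mul {f g : E → ℂ} (hf : ContDiff ℝ ∞ f) (hg : ContDiff ℝ ∞ g) (v : E) :
    dirDeriv v (f * g) = dirDeriv v f * g + f * dirDeriv v g := by
  funext p
  simp only [dirDeriv, Pi.add_apply, Pi.mul_apply]
  rw [fderiv_mul (differentiableAt_of_smooth hf p) (differentiableAt_of_smooth hg p)]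
  simp only [add_apply, smul_apply, smul_eq_mul]
  ring

theorem dirDeriv_clm_comp {f : E → G} (hf : ContDiff ℝ ∞ f) (T : G →L[ℝ] G') (v : E) :
    dirDeriv v (T ∘ f) = T ∘ dirDeriv v f := by
  funext p
  exact congrArg (· v)
    (T.hasFDerivAt.comp p (differentiableAt_of_smooth hf p).hasFDerivAt).fderiv

theorem dirDeriv_comp_clm {F : Type*} [NormedAddCommGroup F] [NormedSpace ℝ F] {f : F → G}
    (hf : ContDiff ℝ ∞ f) (T : E →L[ℝ] F) (v : E) :
    dirDeriv v (f ∘ T) = dirDeriv (T v) f ∘ T := by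
  funext p
  exact congrArg (· v)
    ((differentiableAt_of_smooth hf (T p)).hasFDerivAt.comp p T.hasFDerivAt).fderiv

theorem contDiff_star {f : E → ℂ} (hf : ContDiff ℝ ∞ f) : ContDiff ℝ ∞ (star f) :=
  (Complex.conjCLE : ℂ →L[ℝ] ℂ).contDiff.comp hf

theorem hasCompactSupport_star {X : Type*} [TopologicalSpace X] {f : X → ℂ}
    (hf : HasCompactSupport f) : HasCompactSupport (star f) :=
  hf.comp_left (g := star) (star_zero ℂ)

theorem dirDeriv_star {f : E → ℂ} (hf : ContDiff ℝ ∞ f) (v : E) :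
    dirDeriv v (star f) = star (dirDeriv v f) :=
  dirDeriv_clm_comp hf (Complex.conjCLE : ℂ →L[ℝ] ℂ) v

theorem contDiff_ofReal {f : E → ℝ} (hf : ContDiff ℝ ∞ f) :
    ContDiff ℝ ∞ (fun p => (f p : ℂ)) :=
  Complex.ofRealCLM.contDiff.comp hf

theorem dirDeriv_ofReal {f : E → ℝ} (hf : ContDiff ℝ ∞ f) (v : E) :
    dirDeriv v (fun p => (f p : ℂ)) = fun p => ((dirDeriv v f p : ℝ) : ℂ) :=
  dirDeriv_clm_comp hf Complex.ofRealCLM v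

theorem dirDeriv_eq_zero_of_eventually_eq {f : E → G} {p v : E} {c : G}
    (hf : DifferentiableAt ℝ f p) (h : ∀ᶠ t : ℝ in 𝓝 0, f (p + t • v) = c) :
    dirDeriv v f p = 0 :=
  (hf.hasFDerivAt.hasLineDerivAt v).unique
    ((hasDerivAt_const (0 : ℝ) c).congr_of_eventuallyEq h)

end DirectionalDerivative

section Vanishing

variable {E G G' : Type*} [NormedAddCommGroup E] [NormedSpace ℝ E]
  [NormedAddCommGroup G] [NormedSpace ℝ G] [NormedAddCommGroup G'] [NormedSpace ℝ G']

/-- `f` vanishes to order `n` on `Z`: all iterated directional derivatives of order `< n` are zero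
at the points of `Z`. -/
def VanishTo (Z : Set E) : ℕ → (E → G) → Prop
  | 0, _ => True
  | n + 1, f => (∀ p ∈ Z, f p = 0) ∧ ∀ v, VanishTo Z n (dirDeriv v f)

namespace VanishTo

variable {Z : Set E} {n : ℕ}

theorem of_succ {f : E → G} (h : VanishTo Z (n + 1) f) : VanishTo Z n f := by
  induction n generalizing f with
  | zero => trivial
  | succ n ih => exact ⟨h.1, fun v => ih (h.2 v)⟩

theorem add {f g : E → G} (hf : ContDiff ℝ ∞ f) (hg : ContDiff ℝ ∞ g)
    (h : VanishTo Z n f) (h' : VanishTo Z n g) : VanishTo Z n (f + g) := by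
  induction n generalizing f g with
  | zero => trivial
  | succ n ih =>
    refine ⟨fun p hp => by simp [h.1 p hp, h'.1 p hp], fun v => ?_⟩
    rw [dirDeriv_add hf hg]
    exact ih (contDiff_dirDeriv hf v) (contDiff_dirDeriv hg v) (h.2 v) (h'.2 v)

theorem smul {f : E → G} (c : ℝ) (h : VanishTo Z n f) : VanishTo Z n (c • f) := by
  induction n generalizing f with
  | zero => trivial
  | succ n ih =>
    refine ⟨fun p hp => by simp [h.1 p hp], fun v => ?_⟩
    rw [dirDeriv_smul]
    exact ih (h.2 v)

theorem mul_left {f g : E → ℂ} (hf : ContDiff ℝ ∞ f) (hg : ContDiff ℝ ∞ g)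
    (h : VanishTo Z n g) : VanishTo Z n (f * g) := by
  induction n generalizing f g with
  | zero => trivial
  | succ n ih =>
    refine ⟨fun p hp => by simp [h.1 p hp], fun v => ?_⟩
    have hf' := contDiff_dirDeriv hf v
    have hg' := contDiff_dirDeriv hg v
    rw [dirDeriv_mul hf hg]
    exact add (hf'.mul hg) (hf.mul hg') (ih hf' hg h.of_succ) (ih hf hg' (h.2 v))

theorem sub {f g : E → G} (hf : ContDiff ℝ ∞ f) (hg : ContDiff ℝ ∞ g)
    (h : VanishTo Z n f) (h' : VanishTo Z n g) : VanishTo Z n (f - g) := by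
  have hneg := h'.smul (-1)
  rw [neg_one_smul] at hneg
  rw [sub_eq_add_neg]
  exact h.add hf hg.neg hneg

theorem clm_comp {f : E → G} (hf : ContDiff ℝ ∞ f) (T : G →L[ℝ] G') (h : VanishTo Z n f) :
    VanishTo Z n (T ∘ f) := by
  induction n generalizing f with
  | zero => trivial
  | succ n ih =>
    refine ⟨fun p hp => by simp [h.1 p hp], fun v => ?_⟩
    rw [dirDeriv_clm_comp hf]
    exact ih (contDiff_dirDeriv hf v) (h.2 v)

theorem conj {f : E → ℂ} (hf : ContDiff ℝ ∞ f) (h : VanishTo Z n f) : VanishTo Z n (star f) :=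
  h.clm_comp hf (Complex.conjCLE : ℂ →L[ℝ] ℂ)

end VanishTo

variable {C : Set E} {y : E →L[ℝ] ℝ}

theorem dirDeriv_eq_zero_of_tangent (hC : IsOpen C) {f : E → G} (hf : ContDiff ℝ ∞ f)
    (h : ∀ p ∈ C ∩ {p | y p = 0}, f p = 0) {v : E} (hv : y v = 0) :
    ∀ p ∈ C ∩ {p | y p = 0}, dirDeriv v f p = 0 := by
  rintro p ⟨hpC, hpy : y p = 0⟩
  refine dirDeriv_eq_zero_of_eventually_eq (c := 0) (differentiableAt_of_smooth hf p) ?_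
  have hc : ContinuousAt (fun t : ℝ => p + t • v) 0 := by fun_prop
  filter_upwards [hc.eventually_mem (by simpa using hC.mem_nhds hpC)] with t ht
  exact h _ ⟨ht, by simp [hv, hpy]⟩

theorem VanishTo.dirDeriv_tangent (hC : IsOpen C) {n : ℕ} {f : E → G} (hf : ContDiff ℝ ∞ f)
    (h : VanishTo (C ∩ {p | y p = 0}) n f) {v : E} (hv : y v = 0) :
    VanishTo (C ∩ {p | y p = 0}) n (dirDeriv v f) := by
  induction n generalizing f with
  | zero => trivial
  | succ n ih =>
    refine ⟨dirDeriv_eq_zero_of_tangent hC hf h.1 hv, fun w => ?_⟩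
    rw [dirDeriv_comm hf]
    exact ih (contDiff_dirDeriv hf w) (h.2 w)

theorem VanishTo.succ_of_normal (hC : IsOpen C) {Y : E} (hY : y Y = 1) {n : ℕ} {f : E → G}
    (hf : ContDiff ℝ ∞ f) (h0 : ∀ p ∈ C ∩ {p | y p = 0}, f p = 0)
    (h : VanishTo (C ∩ {p | y p = 0}) n (dirDeriv Y f)) :
    VanishTo (C ∩ {p | y p = 0}) (n + 1) f := by
  induction n with
  | zero => exact ⟨h0, fun _ => trivial⟩
  | succ n ih =>
    refine ⟨h0, fun w => ?_⟩
    have ht : y (w - y w • Y) = 0 := by simp [hY]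
    have hw : dirDeriv w f = dirDeriv (w - y w • Y) f + y w • dirDeriv Y f := by
      rw [← dirDeriv_add_smul_dir, sub_add_cancel]
    rw [hw]
    exact ((ih h.of_succ).dirDeriv_tangent hC hf ht).add (contDiff_dirDeriv hf _)
      (contDiff_const.smul (contDiff_dirDeriv hf Y)) (h.smul (y w))

theorem eq_zero_on_hyperplane_of_side (hC : IsOpen C) {Y : E} (hY : 0 < y Y) {T : Type*}
    [TopologicalSpace T] [T2Space T] [Zero T] {f : E → T} (hf : Continuous f)
    (h : ∀ p ∈ C, 0 < y p → f p = 0) :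
    ∀ p ∈ C ∩ {p | y p = 0}, f p = 0 := by
  rintro p ⟨hpC, hpy : y p = 0⟩
  have hc : Continuous (fun t : ℝ => p + t • Y) := by fun_prop
  have hlim : Tendsto (fun t : ℝ => f (p + t • Y)) (𝓝[>] 0) (𝓝 (f p)) :=
    ((hf.comp hc).tendsto' 0 _ (by simp)).mono_left nhdsWithin_le_nhds
  have hzero : ∀ᶠ t : ℝ in 𝓝[>] 0, f (p + t • Y) = 0 := by
    filter_upwards [nhdsWithin_le_nhds (hc.continuousAt.eventually_mem
      (by simpa using hC.mem_nhds hpC)), self_mem_nhdsWithin] with t htC ht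
    exact h _ htC (by simpa [hpy] using mul_pos ht hY)
  exact tendsto_nhds_unique (hlim.congr' hzero) tendsto_const_nhds

theorem vanishTo_of_side (hC : IsOpen C) {Y : E} (hY : 0 < y Y) {f : E → G}
    (hf : ContDiff ℝ ∞ f) (h : ∀ p ∈ C, 0 < y p → f p = 0) (n : ℕ) :
    VanishTo (C ∩ {p | y p = 0}) n f := by
  induction n generalizing f with
  | zero => trivial
  | succ n ih =>
    refine ⟨eq_zero_on_hyperplane_of_side hC hY hf.continuous h, fun v =>
      ih (contDiff_dirDeriv hf v) fun p hp hy => ?_⟩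
    refine dirDeriv_eq_zero_of_eventually_eq (c := 0) (differentiableAt_of_smooth hf p) ?_
    have hc : ContinuousAt (fun t : ℝ => p + t • v) 0 := by fun_prop
    have hmem : C ∩ {q | 0 < y q} ∈ 𝓝 p :=
      (hC.inter (isOpen_lt continuous_const y.continuous)).mem_nhds ⟨hp, hy⟩
    filter_upwards [hc.eventually_mem (by simpa only [zero_smul, add_zero] using hmem)] with t ht
    exact h _ ht.1 ht.2

/-- The function equal to `f` on the half-space `y ≥ 0` and to `0` elsewhere. -/
noncomputable def cutSide {T : Type*} [Zero T] (y : E →L[ℝ] ℝ) (f : E → T) : E → T :=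
  {p | 0 ≤ y p}.indicator f

theorem cutSide_of_nonneg {T : Type*} [Zero T] {f : E → T} {p : E} (hp : 0 ≤ y p) :
    cutSide y f p = f p := by
  simp [cutSide, hp]

theorem cutSide_of_neg {T : Type*} [Zero T] {f : E → T} {p : E} (hp : y p < 0) :
    cutSide y f p = 0 := by
  simp [cutSide, hp]

theorem hasFDerivAt_cutSide {f : E → G} (hf : ContDiff ℝ ∞ f)
    (h : VanishTo (C ∩ {p | y p = 0}) 2 f) {p : E} (hp : p ∈ C) :
    HasFDerivAt (cutSide y f) ({p | 0 ≤ y p}.indicator (fderiv ℝ f) p) p := by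
  have hd := (differentiableAt_of_smooth hf p).hasFDerivAt
  rcases lt_trichotomy (y p) 0 with hy | hy | hy
  · rw [Set.indicator_of_notMem (by simpa using hy)]
    refine (hasFDerivAt_const 0 p).congr_of_eventuallyEq ?_
    filter_upwards [y.continuous.continuousAt.eventually (gt_mem_nhds hy)] with q hq
    exact cutSide_of_neg hq
  · have hf0 : f p = 0 := h.1 p ⟨hp, hy⟩
    have hdf0 : fderiv ℝ f p = 0 := by
      ext v
      exact (h.2 v).1 p ⟨hp, hy⟩
    rw [Set.indicator_of_mem (by simp [hy]), hdf0]
    rw [hdf0, hasFDerivAt_iff_isLittleO] at hd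
    rw [hasFDerivAt_iff_isLittleO]
    refine (Asymptotics.IsBigO.of_bound 1 (.of_forall fun q => ?_)).trans_isLittleO hd
    simp only [cutSide_of_nonneg hy.ge, hf0, sub_zero, zero_apply, one_mul]
    exact norm_indicator_le_norm_self (s := {p | 0 ≤ y p}) f q
  · rw [Set.indicator_of_mem (by simpa using hy.le)]
    refine hd.congr_of_eventuallyEq ?_
    filter_upwards [y.continuous.continuousAt.eventually (lt_mem_nhds hy)] with q hq
    exact cutSide_of_nonneg hq.le

theorem contDiffOn_cutSide [FiniteDimensional ℝ E] (hC : IsOpen C) {f : E → G}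
    (hf : ContDiff ℝ ∞ f) (h : ∀ n, VanishTo (C ∩ {p | y p = 0}) n f) :
    ContDiffOn ℝ ∞ (cutSide y f) C := by
  refine contDiffOn_infty.2 fun n => ?_
  induction n generalizing f with
  | zero =>
    exact contDiffOn_zero.2 fun p hp =>
      (hasFDerivAt_cutSide hf (h 2) hp).continuousAt.continuousWithinAt
  | succ n ih =>
    rw [Nat.cast_succ, contDiffOn_succ_iff_fderiv_of_isOpen hC]
    refine ⟨fun p hp =>
      (hasFDerivAt_cutSide hf (h 2) hp).differentiableAt.differentiableWithinAt, by simp,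
      contDiffOn_clm_apply.2 fun v => ?_⟩
    refine (ih (contDiff_dirDeriv hf v) fun n => (h (n + 1)).2 v).congr fun p hp => ?_
    rw [(hasFDerivAt_cutSide hf (h 2) hp).fderiv]
    by_cases hy : 0 ≤ y p <;> simp [cutSide, hy, dirDeriv]

end Vanishing

section FrameDerivative

variable {E ι : Type*} [NormedAddCommGroup E] [NormedSpace ℝ E] [Fintype ι]
  {v : ι → E} {c d : ι → E → ℂ} {f g : E → ℂ}

/-- The complex vector field `∑ i, c i ∂_{v i}` acting on functions. The complex conjugate field
is `frameDeriv v (star c)`. -/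
noncomputable def frameDeriv (v : ι → E) (c : ι → E → ℂ) (f : E → ℂ) : E → ℂ :=
  ∑ i, c i * dirDeriv (v i) f

/-- The divergence of the complex vector field `∑ i, c i ∂_{v i}`. -/
noncomputable def frameDiv (v : ι → E) (c : ι → E → ℂ) : E → ℂ :=
  ∑ i, dirDeriv (v i) (c i)

theorem contDiff_sum (hc : ∀ i, ContDiff ℝ ∞ (c i)) : ContDiff ℝ ∞ (∑ i, c i) := by
  simpa only [Finset.sum_fn] using ContDiff.sum fun i _ => hc i

theorem contDiff_frameDeriv (hc : ∀ i, ContDiff ℝ ∞ (c i)) (hf : ContDiff ℝ ∞ f) :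
    ContDiff ℝ ∞ (frameDeriv v c f) :=
  contDiff_sum fun i => (hc i).mul (contDiff_dirDeriv hf (v i))

theorem contDiff_frameDiv (hc : ∀ i, ContDiff ℝ ∞ (c i)) : ContDiff ℝ ∞ (frameDiv v c) :=
  contDiff_sum fun i => contDiff_dirDeriv (hc i) (v i)

theorem frameDeriv_eq_zero_of_notMem_tsupport {p : E} (hp : p ∉ tsupport f) :
    frameDeriv v c f p = 0 := by
  have h0 (i : ι) : dirDeriv (v i) f p = 0 := by
    simp [dirDeriv, (notMem_tsupport_iff_eventuallyEq.1 hp).fderiv_eq]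
  simp [frameDeriv, h0]

theorem hasCompactSupport_frameDeriv (hf : HasCompactSupport f) :
    HasCompactSupport (frameDeriv v c f) :=
  hf.mono' fun _ hp => not_imp_comm.1 frameDeriv_eq_zero_of_notMem_tsupport hp

theorem frameDeriv_congr {p : E} (h : f =ᶠ[𝓝 p] g) :
    frameDeriv v c f p = frameDeriv v c g p := by
  simp only [frameDeriv, Finset.sum_apply, Pi.mul_apply, dirDeriv_congr h]

theorem frameDeriv_add (hf : ContDiff ℝ ∞ f) (hg : ContDiff ℝ ∞ g) :
    frameDeriv v c (f + g) = frameDeriv v c f + frameDeriv v c g := by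
  simp only [frameDeriv, dirDeriv_add hf hg, mul_add, Finset.sum_add_distrib]

theorem frameDeriv_mul (hf : ContDiff ℝ ∞ f) (hg : ContDiff ℝ ∞ g) :
    frameDeriv v c (f * g) = frameDeriv v c f * g + f * frameDeriv v c g := by
  simp only [frameDeriv, dirDeriv_mul hf hg, Finset.sum_mul, Finset.mul_sum,
    ← Finset.sum_add_distrib]
  exact Finset.sum_congr rfl fun i _ => by ring

theorem frameDeriv_smul (a : ℝ) : frameDeriv v c (a • f) = a • frameDeriv v c f := by
  simp only [frameDeriv, dirDeriv_smul, mul_smul_comm, Finset.smul_sum]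

theorem frameDeriv_star (hf : ContDiff ℝ ∞ f) :
    frameDeriv v (star c) (star f) = star (frameDeriv v c f) := by
  simp only [frameDeriv, dirDeriv_star hf, star_sum, star_mul', Pi.star_apply]

theorem frameDeriv_frameDeriv (hd : ∀ i, ContDiff ℝ ∞ (d i)) (hf : ContDiff ℝ ∞ f) :
    frameDeriv v c (frameDeriv v d f) = frameDeriv v (fun i => frameDeriv v c (d i)) f +
      ∑ i, ∑ j, c i * d j * dirDeriv (v i) (dirDeriv (v j) f) := by
  have hdf (i : ι) : ContDiff ℝ ∞ (d i * dirDeriv (v i) f) :=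
    (hd i).mul (contDiff_dirDeriv hf (v i))
  have expand (i : ι) : c i * dirDeriv (v i) (frameDeriv v d f) =
      ∑ j, c i * dirDeriv (v i) (d j) * dirDeriv (v j) f +
        ∑ j, c i * d j * dirDeriv (v i) (dirDeriv (v j) f) := by
    rw [frameDeriv, dirDeriv_sum hdf, Finset.mul_sum, ← Finset.sum_add_distrib]
    refine Finset.sum_congr rfl fun j _ => ?_
    rw [dirDeriv_mul (hd j) (contDiff_dirDeriv hf (v j))]
    ring
  rw [frameDeriv, Finset.sum_congr rfl fun i _ => expand i, Finset.sum_add_distrib,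
    Finset.sum_comm]
  simp only [frameDeriv, Finset.sum_mul]

theorem frameDeriv_comm (hc : ∀ i, ContDiff ℝ ∞ (c i)) (hd : ∀ i, ContDiff ℝ ∞ (d i))
    (hf : ContDiff ℝ ∞ f) {p : E}
    (h : ∀ i, frameDeriv v c (d i) p = frameDeriv v d (c i) p) :
    frameDeriv v c (frameDeriv v d f) p = frameDeriv v d (frameDeriv v c f) p := by
  rw [frameDeriv_frameDeriv hd hf, frameDeriv_frameDeriv hc hf, Finset.sum_comm]
  simp only [dirDeriv_comm hf, mul_comm (c _) (d _)]
  have swap : frameDeriv v (fun i => frameDeriv v c (d i)) f p =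
      frameDeriv v (fun i => frameDeriv v d (c i)) f p := by
    simp only [frameDeriv, Finset.sum_apply, Pi.mul_apply] at h ⊢
    simp only [h]
  simp only [Pi.add_apply, swap]

end FrameDerivative

section Carleman

open MeasureTheory

variable {E ι : Type*} [NormedAddCommGroup E] [NormedSpace ℝ E] [Fintype ι]
  {v : ι → E} {c d : ι → E → ℂ} {a b f g u w : E → ℂ}

/-- The first-order operator `u ↦ ∑ i, c i ∂_{v i} u + a u`. -/
noncomputable def firstOrderOp (v : ι → E) (c : ι → E → ℂ) (a u : E → ℂ) : E → ℂ :=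
  frameDeriv v c u + a * u

/-- The zeroth-order coefficient of the formal adjoint of `firstOrderOp v c a`, which is
`-firstOrderOp v (star c) (adjointCoeff v c a)`. -/
noncomputable def adjointCoeff (v : ι → E) (c : ι → E → ℂ) (a : E → ℂ) : E → ℂ :=
  frameDiv v (star c) - star a

theorem contDiff_firstOrderOp (hc : ∀ i, ContDiff ℝ ∞ (c i)) (ha : ContDiff ℝ ∞ a)
    (hu : ContDiff ℝ ∞ u) : ContDiff ℝ ∞ (firstOrderOp v c a u) :=
  (contDiff_frameDeriv hc hu).add (ha.mul hu)

theorem hasCompactSupport_firstOrderOp (hu : HasCompactSupport u) :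
    HasCompactSupport (firstOrderOp v c a u) :=
  (hasCompactSupport_frameDeriv hu).add hu.mul_left

theorem contDiff_adjointCoeff (hc : ∀ i, ContDiff ℝ ∞ (c i)) (ha : ContDiff ℝ ∞ a) :
    ContDiff ℝ ∞ (adjointCoeff v c a) :=
  (contDiff_frameDiv fun i => contDiff_star (hc i)).sub (contDiff_star ha)

theorem firstOrderOp_comm (hc : ∀ i, ContDiff ℝ ∞ (c i)) (hd : ∀ i, ContDiff ℝ ∞ (d i))
    (ha : ContDiff ℝ ∞ a) (hb : ContDiff ℝ ∞ b) (hu : ContDiff ℝ ∞ u) {p : E}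
    (h : ∀ i, frameDeriv v c (d i) p = frameDeriv v d (c i) p) :
    firstOrderOp v c a (firstOrderOp v d b u) p = firstOrderOp v d b (firstOrderOp v c a u) p +
      (frameDeriv v c b - frameDeriv v d a) p * u p := by
  have comm := frameDeriv_comm hc hd hu h
  have hbu : ContDiff ℝ ∞ (b * u) := hb.mul hu
  have hau : ContDiff ℝ ∞ (a * u) := ha.mul hu
  simp only [firstOrderOp]
  rw [frameDeriv_add (contDiff_frameDeriv hd hu) hbu, frameDeriv_mul hb hu,
    frameDeriv_add (contDiff_frameDeriv hc hu) hau, frameDeriv_mul ha hu]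
  simp only [Pi.add_apply, Pi.mul_apply, Pi.sub_apply, comm]
  ring

/-- The zeroth-order part of the commutator of `firstOrderOp v c a` and minus its adjoint. -/
noncomputable def carlemanCoeff (v : ι → E) (c : ι → E → ℂ) (a : E → ℂ) : E → ℂ :=
  frameDeriv v c (adjointCoeff v c a) - frameDeriv v (star c) a

theorem contDiff_carlemanCoeff (hc : ∀ i, ContDiff ℝ ∞ (c i)) (ha : ContDiff ℝ ∞ a) :
    ContDiff ℝ ∞ (carlemanCoeff v c a) :=
  (contDiff_frameDeriv hc (contDiff_adjointCoeff hc ha)).sub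
    (contDiff_frameDeriv (fun i => contDiff_star (hc i)) ha)

theorem hasCompactSupport_normSq {X : Type*} [TopologicalSpace X] {f : X → ℂ}
    (hf : HasCompactSupport f) : HasCompactSupport (fun p => ‖f p‖ ^ 2) :=
  hf.comp_left (g := fun z => ‖z‖ ^ 2) (by simp)

theorem integral_mul_star_self {X : Type*} [MeasurableSpace X] (μ : Measure X) (f : X → ℂ) :
    ∫ p, (f * star f) p ∂μ = ((∫ p, ‖f p‖ ^ 2 ∂μ : ℝ) : ℂ) := by
  rw [← integral_complex_ofReal]
  simp [Complex.mul_conj']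

variable [FiniteDimensional ℝ E] [MeasurableSpace E] [BorelSpace E] (μ : Measure E)
  [μ.IsAddHaarMeasure]

theorem integral_dirDeriv_mul (hf : ContDiff ℝ ∞ f) (hg : ContDiff ℝ ∞ g)
    (hcg : HasCompactSupport g) (v : E) :
    ∫ p, (dirDeriv v f * g) p ∂μ = -∫ p, (f * dirDeriv v g) p ∂μ := by
  have hf' := contDiff_dirDeriv hf v
  have hg' := contDiff_dirDeriv hg v
  refine neg_eq_iff_eq_neg.1 (integral_mul_fderiv_eq_neg_fderiv_mul_of_integrable
    ((hf'.mul hg).continuous.integrable_of_hasCompactSupport hcg.mul_left)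
    ((hf.mul hg').continuous.integrable_of_hasCompactSupport
      (hasCompactSupport_dirDeriv hcg v).mul_left)
    ((hf.mul hg).continuous.integrable_of_hasCompactSupport hcg.mul_left)
    (fun p _ => differentiableAt_of_smooth hf p)
    (fun p _ => differentiableAt_of_smooth hg p)).symm

theorem integral_frameDeriv_mul (hc : ∀ i, ContDiff ℝ ∞ (c i)) (hf : ContDiff ℝ ∞ f)
    (hg : ContDiff ℝ ∞ g) (hcg : HasCompactSupport g) :
    ∫ p, (frameDeriv v c f * g) p ∂μ =
      -∫ p, (f * (frameDeriv v c g + frameDiv v c * g)) p ∂μ := by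
  have hcg' (i : ι) : ContDiff ℝ ∞ (c i * g) := (hc i).mul hg
  have left : frameDeriv v c f * g = ∑ i, dirDeriv (v i) f * (c i * g) := by
    rw [frameDeriv, Finset.sum_mul]
    exact Finset.sum_congr rfl fun i _ => by ring
  have right : f * (frameDeriv v c g + frameDiv v c * g) =
      ∑ i, f * dirDeriv (v i) (c i * g) := by
    rw [frameDeriv, frameDiv, Finset.sum_mul, ← Finset.sum_add_distrib, Finset.mul_sum]
    exact Finset.sum_congr rfl fun i _ => by rw [dirDeriv_mul (hc i) hg]; ring
  simp only [left, right, Finset.sum_apply]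
  rw [integral_finsetSum _ fun i _ => ?_, integral_finsetSum _ fun i _ => ?_,
    ← Finset.sum_neg_distrib]
  · exact Finset.sum_congr rfl fun i _ =>
      integral_dirDeriv_mul μ hf (hcg' i) hcg.mul_left (v i)
  · exact (hf.mul (contDiff_dirDeriv (hcg' i) (v i))).continuous.integrable_of_hasCompactSupport
      (hasCompactSupport_dirDeriv hcg.mul_left (v i)).mul_left
  · exact ((contDiff_dirDeriv hf (v i)).mul (hcg' i)).continuous.integrable_of_hasCompactSupport
      hcg.mul_left.mul_left

theorem integral_firstOrderOp_mul_star (hc : ∀ i, ContDiff ℝ ∞ (c i)) (ha : ContDiff ℝ ∞ a)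
    (hu : ContDiff ℝ ∞ u) (hw : ContDiff ℝ ∞ w) (hcw : HasCompactSupport w) :
    ∫ p, (firstOrderOp v c a u * star w) p ∂μ =
      -∫ p, (u * star (firstOrderOp v (star c) (adjointCoeff v c a) w)) p ∂μ := by
  have hw' := contDiff_star hw
  have hcw' := hasCompactSupport_star hcw
  have hdiv : star (frameDiv v (star c)) = frameDiv v c := by
    simp only [frameDiv, star_sum, Pi.star_apply, dirDeriv_star (hc _), star_star]
  have adjoint : u * star (firstOrderOp v (star c) (adjointCoeff v c a) w) =
      u * (frameDeriv v c (star w) + frameDiv v c * star w) - a * u * star w := by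
    rw [firstOrderOp, adjointCoeff, star_add, star_mul', star_sub, star_star, hdiv,
      ← frameDeriv_star hw, star_star]
    ring
  have hcont : ContDiff ℝ ∞ (u * (frameDeriv v c (star w) + frameDiv v c * star w)) :=
    hu.mul ((contDiff_frameDeriv hc hw').add ((contDiff_frameDiv hc).mul hw'))
  have hsupp : HasCompactSupport (u * (frameDeriv v c (star w) + frameDiv v c * star w)) :=
    ((hasCompactSupport_frameDeriv hcw').add hcw'.mul_left).mul_left
  rw [adjoint, firstOrderOp, add_mul]
  simp only [Pi.add_apply, Pi.sub_apply]
  rw [integral_add, integral_sub, integral_frameDeriv_mul μ hc hu hw' hcw']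
  · ring
  · exact hcont.continuous.integrable_of_hasCompactSupport hsupp
  · exact ((ha.mul hu).mul hw').continuous.integrable_of_hasCompactSupport hcw'.mul_left
  · exact ((contDiff_frameDeriv hc hu).mul hw').continuous.integrable_of_hasCompactSupport
      hcw'.mul_left
  · exact ((ha.mul hu).mul hw').continuous.integrable_of_hasCompactSupport hcw'.mul_left

theorem integral_firstOrderOp_mul_star_self (hc : ∀ i, ContDiff ℝ ∞ (c i))
    (ha : ContDiff ℝ ∞ a) (hu : ContDiff ℝ ∞ u) (hcu : HasCompactSupport u)
    (h : ∀ p, u p ≠ 0 → ∀ i, frameDeriv v c (star (c i)) p = frameDeriv v (star c) (c i) p) :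
    ∫ p, (firstOrderOp v c a u * star (firstOrderOp v c a u)) p ∂μ =
      ∫ p, (firstOrderOp v (star c) (adjointCoeff v c a) u *
        star (firstOrderOp v (star c) (adjointCoeff v c a) u)) p ∂μ +
      ∫ p, (carlemanCoeff v c a * u * star u) p ∂μ := by
  have hc' (i : ι) : ContDiff ℝ ∞ ((star c) i) := contDiff_star (hc i)
  have ha' := contDiff_adjointCoeff (v := v) hc ha
  set T := firstOrderOp v c a with hT
  set T' := firstOrderOp v (star c) (adjointCoeff v c a) with hT'
  have hTu : ContDiff ℝ ∞ (T u) := contDiff_firstOrderOp hc ha hu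
  have hT'u : ContDiff ℝ ∞ (T' u) := contDiff_firstOrderOp hc' ha' hu
  have hcTu : HasCompactSupport (T u) := hasCompactSupport_firstOrderOp hcu
  have adj₁ : ∫ p, (T u * star (T u)) p ∂μ = -∫ p, (T' (T u) * star u) p ∂μ := by
    rw [integral_mul_star_self, ← Complex.conj_ofReal, ← integral_mul_star_self,
      integral_firstOrderOp_mul_star μ hc ha hu hTu hcTu, map_neg, ← integral_conj]
    simp [mul_comm, hT']
  have adj₂ : ∫ p, (T (T' u) * star u) p ∂μ = -∫ p, (T' u * star (T' u)) p ∂μ :=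
    integral_firstOrderOp_mul_star μ hc ha hT'u hu hcu
  have comm : T (T' u) * star u = T' (T u) * star u + carlemanCoeff v c a * u * star u := by
    funext p
    by_cases hp : u p = 0
    · simp [hp]
    · simp only [Pi.mul_apply, Pi.add_apply, hT, hT', carlemanCoeff,
        firstOrderOp_comm hc hc' ha ha' hu (h p hp)]
      ring
  simp only [comm, Pi.add_apply] at adj₂
  rw [integral_add] at adj₂
  · rw [adj₁]
    linear_combination -adj₂
  · exact ((contDiff_firstOrderOp hc' ha' hTu).mul
      (contDiff_star hu)).continuous.integrable_of_hasCompactSupport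
      (hasCompactSupport_star hcu).mul_left
  · exact (((contDiff_carlemanCoeff hc ha).mul hu).mul
      (contDiff_star hu)).continuous.integrable_of_hasCompactSupport
      (hasCompactSupport_star hcu).mul_left

theorem carleman_inequality (hc : ∀ i, ContDiff ℝ ∞ (c i))
    (ha : ContDiff ℝ ∞ a) (hu : ContDiff ℝ ∞ u) (hcu : HasCompactSupport u)
    (h : ∀ p, u p ≠ 0 → ∀ i, frameDeriv v c (star (c i)) p = frameDeriv v (star c) (c i) p)
    {A : ℝ} (hA : ∀ p, u p ≠ 0 → A ≤ (carlemanCoeff v c a p).re) :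
    A * ∫ p, ‖u p‖ ^ 2 ∂μ ≤ ∫ p, ‖firstOrderOp v c a u p‖ ^ 2 ∂μ := by
  set κ := carlemanCoeff v c a
  have intκ : Integrable (κ * u * star u) μ :=
    (((contDiff_carlemanCoeff hc ha).mul hu).mul
      (contDiff_star hu)).continuous.integrable_of_hasCompactSupport
      (hasCompactSupport_star hcu).mul_left
  have identity := congrArg Complex.re (integral_firstOrderOp_mul_star_self μ hc ha hu hcu h)
  rw [Complex.add_re, integral_mul_star_self, integral_mul_star_self, Complex.ofReal_re,
    Complex.ofReal_re] at identity
  have adjoint_nonneg :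
      0 ≤ ∫ p, ‖firstOrderOp v (star c) (adjointCoeff v c a) u p‖ ^ 2 ∂μ :=
    integral_nonneg fun p => by positivity
  have lower : A * ∫ p, ‖u p‖ ^ 2 ∂μ ≤ (∫ p, (κ * u * star u) p ∂μ).re := by
    rw [← integral_const_mul]
    refine (integral_mono (Integrable.const_mul
      ((hu.continuous.norm.pow 2).integrable_of_hasCompactSupport
        (hasCompactSupport_normSq hcu)) A) intκ.re fun p => ?_).trans_eq (integral_re intκ)
    by_cases hp : u p = 0
    · simp [hp]
    · have re_eq : RCLike.re ((κ * u * star u) p) = (κ p).re * ‖u p‖ ^ 2 := by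
        simp only [Pi.mul_apply, Pi.star_apply, mul_assoc, RCLike.star_def, Complex.mul_conj',
          RCLike.re_eq_complex_re]
        rw [← Complex.ofReal_pow, Complex.re_mul_ofReal]
      rw [re_eq]
      exact mul_le_mul_of_nonneg_right (hA p hp) (sq_nonneg _)
  linarith

end Carleman

section UniqueContinuation

open MeasureTheory

variable {X : Type*} [TopologicalSpace X] [MeasurableSpace X] [BorelSpace X] {μ : Measure X}
  [IsFiniteMeasureOnCompacts μ] {φ h : X → ℝ} {A κ : ℝ}

theorem integral_max_mul_le_of_integral_exp_le (hφ : Continuous φ) (hh : Continuous h)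
    (hch : HasCompactSupport h) (hnonneg : ∀ p, 0 ≤ h p) {τ : ℝ} (hτ : 0 ≤ τ)
    (hle : ∫ p, Real.exp (2 * τ * φ p) * h p ∂μ ≤ A * Real.exp (-2 * τ * κ)) :
    2 * τ * ∫ p, max (φ p + κ) 0 * h p ∂μ ≤ A := by
  have pointwise (p : X) : 2 * τ * (max (φ p + κ) 0 * h p) ≤
      Real.exp (2 * τ * κ) * (Real.exp (2 * τ * φ p) * h p) := by
    rw [← mul_assoc, ← mul_assoc, ← Real.exp_add, ← mul_add]
    refine mul_le_mul_of_nonneg_right ?_ (hnonneg p)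
    rw [mul_max_of_nonneg _ _ (by positivity), mul_zero, add_comm κ]
    exact max_le ((le_add_of_nonneg_right zero_le_one).trans (Real.add_one_le_exp _))
      (Real.exp_pos _).le
  have hmax : Continuous fun p => max (φ p + κ) 0 * h p := by fun_prop
  have hexp : Continuous fun p => Real.exp (2 * τ * φ p) * h p := by fun_prop
  have integrated := integral_mono
    ((hmax.integrable_of_hasCompactSupport hch.mul_left (μ := μ)).const_mul (2 * τ))
    ((hexp.integrable_of_hasCompactSupport hch.mul_left).const_mul _) pointwise
  rw [integral_const_mul, integral_const_mul] at integrated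
  calc 2 * τ * ∫ p, max (φ p + κ) 0 * h p ∂μ
      ≤ Real.exp (2 * τ * κ) * (A * Real.exp (-2 * τ * κ)) :=
        integrated.trans (mul_le_mul_of_nonneg_left hle (Real.exp_pos _).le)
    _ = A * Real.exp (2 * τ * κ + -2 * τ * κ) := by rw [Real.exp_add]; ring
    _ = A := by rw [show 2 * τ * κ + -2 * τ * κ = 0 by ring, Real.exp_zero, mul_one]

theorem eq_zero_of_integral_exp_le [μ.IsOpenPosMeasure] (hφ : Continuous φ) (hh : Continuous h)
    (hch : HasCompactSupport h) (hnonneg : ∀ p, 0 ≤ h p)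
    (hle : ∀ᶠ τ in atTop, ∫ p, Real.exp (2 * τ * φ p) * h p ∂μ ≤ A * Real.exp (-2 * τ * κ))
    {p : X} (hp : -κ < φ p) : h p = 0 := by
  have hmax : Continuous fun q => max (φ q + κ) 0 * h q := by fun_prop
  by_contra hne
  have hpos : 0 < ∫ q, max (φ q + κ) 0 * h q ∂μ :=
    hmax.integral_pos_of_hasCompactSupport_nonneg_nonzero hch.mul_left
      (fun q => mul_nonneg (le_max_right _ _) (hnonneg q)) (x := p)
      (mul_ne_zero (lt_max_of_lt_left (by linarith)).ne' hne)
  have hlim : Tendsto (fun τ : ℝ => 2 * τ * ∫ q, max (φ q + κ) 0 * h q ∂μ) atTop atTop :=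
    (tendsto_id.const_mul_atTop two_pos).atTop_mul_const hpos
  obtain ⟨τ, hint, hτ, hgt⟩ :=
    (hle.and ((eventually_ge_atTop 0).and (hlim.eventually_gt_atTop A))).exists
  exact hgt.not_ge (integral_max_mul_le_of_integral_exp_le hφ hh hch hnonneg hτ hint)

variable {E ι : Type*} [NormedAddCommGroup E] [NormedSpace ℝ E] [Fintype ι]
  {v : ι → E} {c : ι → E → ℂ} {f g : E → ℂ} {φ : E → ℝ}

theorem frameDeriv_ofReal_exp (hφ : ContDiff ℝ ∞ φ) :
    frameDeriv v c (fun p => (Real.exp (φ p) : ℂ)) =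
      (fun p => (Real.exp (φ p) : ℂ)) * frameDeriv v c (fun p => (φ p : ℂ)) := by
  have deriv (w : E) : dirDeriv w (fun p => (Real.exp (φ p) : ℂ)) =
      (fun p => (Real.exp (φ p) : ℂ)) * dirDeriv w (fun p => (φ p : ℂ)) := by
    rw [dirDeriv_ofReal hφ.exp, dirDeriv_ofReal hφ]
    funext p
    simp [dirDeriv, (differentiableAt_of_smooth hφ p).hasFDerivAt.exp.fderiv]
  simp only [frameDeriv, deriv, Finset.mul_sum, mul_left_comm]

theorem re_carlemanCoeff_weight (hc : ∀ i, ContDiff ℝ ∞ (c i)) (hφ : ContDiff ℝ ∞ φ) (τ : ℝ)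
    (p : E) :
    (carlemanCoeff v c ((-τ) • frameDeriv v c fun p => (φ p : ℂ)) p).re =
      (frameDeriv v c (frameDiv v (star c)) p).re +
        2 * τ * (frameDeriv v (star c) (frameDeriv v c fun p => (φ p : ℂ)) p).re := by
  set Lφ := frameDeriv v c fun p => (φ p : ℂ)
  have sLφ : ContDiff ℝ ∞ Lφ := contDiff_frameDeriv hc (contDiff_ofReal hφ)
  have sτLφ : ContDiff ℝ ∞ (τ • star Lφ) := (contDiff_star sLφ).const_smul τ
  have adjoint : adjointCoeff v c ((-τ) • Lφ) = frameDiv v (star c) + τ • star Lφ := by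
    funext p
    simp [adjointCoeff]
  have conj : frameDeriv v c (star Lφ) = star (frameDeriv v (star c) Lφ) := by
    rw [← frameDeriv_star sLφ, star_star]
  have sum : carlemanCoeff v c ((-τ) • Lφ) = frameDeriv v c (frameDiv v (star c)) +
      τ • star (frameDeriv v (star c) Lφ) + τ • frameDeriv v (star c) Lφ := by
    rw [carlemanCoeff, adjoint,
      frameDeriv_add (contDiff_frameDiv (c := star c) fun i => contDiff_star (hc i)) sτLφ,
      frameDeriv_smul, frameDeriv_smul, conj, neg_smul, sub_neg_eq_add]
  simp only [sum, Pi.add_apply, Pi.smul_apply, Pi.star_apply, RCLike.star_def, Complex.add_re,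
    Complex.smul_re, Complex.conj_re, smul_eq_mul]
  ring

variable [FiniteDimensional ℝ E] {x₀ : E}

/-- The product of `f` with the bump function `χ`. -/
noncomputable def cutoff (χ : ContDiffBump x₀) (f : E → ℂ) : E → ℂ :=
  (fun p => (χ p : ℂ)) * f

theorem contDiff_cutoff (hf : ContDiff ℝ ∞ f) (χ : ContDiffBump x₀) :
    ContDiff ℝ ∞ (cutoff χ f) :=
  (contDiff_ofReal χ.contDiff).mul hf

theorem tsupport_cutoff_subset (χ : ContDiffBump x₀) (f : E → ℂ) :
    tsupport (cutoff χ f) ⊆ Metric.closedBall x₀ χ.rOut := by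
  rw [← χ.tsupport_eq]
  exact closure_mono fun p hp => by simpa using left_ne_zero_of_mul hp

theorem hasCompactSupport_cutoff (χ : ContDiffBump x₀) (f : E → ℂ) :
    HasCompactSupport (cutoff χ f) :=
  (isCompact_closedBall x₀ χ.rOut).of_isClosed_subset (isClosed_tsupport _)
    (tsupport_cutoff_subset χ f)

theorem cutoff_eventuallyEq {χ : ContDiffBump x₀} (f : E → ℂ) {p : E}
    (hp : p ∈ Metric.ball x₀ χ.rIn) : cutoff χ f =ᶠ[𝓝 p] f := by
  filter_upwards [Metric.isOpen_ball.mem_nhds hp] with q hq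
  simp [cutoff, χ.one_of_mem_closedBall (Metric.ball_subset_closedBall hq)]

theorem exists_cutoff_bound (hc : ∀ i, ContDiff ℝ ∞ (c i))
    (hf : ContDiff ℝ ∞ f) (χ : ContDiffBump x₀) {C : ℝ}
    (hle : ∀ p ∈ Metric.closedBall x₀ χ.rOut, ‖frameDeriv v c f p‖ ≤ C * ‖f p‖) :
    ∃ D, 0 ≤ D ∧ ∀ p, ‖frameDeriv v c (cutoff χ f) p‖ ^ 2 ≤
      C ^ 2 * ‖cutoff χ f p‖ ^ 2 +
        ((Metric.closedBall x₀ χ.rOut \ Metric.ball x₀ χ.rIn) ∩ {q | f q ≠ 0}).indicator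
          (fun _ => D) p := by
  set A := (Metric.closedBall x₀ χ.rOut \ Metric.ball x₀ χ.rIn) ∩ {q | f q ≠ 0}
  have sg := contDiff_cutoff hf χ
  obtain ⟨D, hD⟩ := (hasCompactSupport_frameDeriv (v := v) (c := c)
    (hasCompactSupport_cutoff χ f)).exists_bound_of_continuous
      (contDiff_frameDeriv hc sg).continuous
  refine ⟨D ^ 2, sq_nonneg D, fun p => ?_⟩
  have hD2 : ‖frameDeriv v c (cutoff χ f) p‖ ^ 2 ≤ D ^ 2 :=
    pow_le_pow_left₀ (norm_nonneg _) (hD p) 2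
  by_cases hpA : p ∈ A
  · rw [Set.indicator_of_mem hpA]
    exact hD2.trans (le_add_of_nonneg_left (by positivity))
  rw [Set.indicator_of_notMem hpA, add_zero, ← mul_pow]
  refine pow_le_pow_left₀ (norm_nonneg _) ?_ 2
  by_cases hout : p ∈ Metric.closedBall x₀ χ.rOut
  · by_cases hin : p ∈ Metric.ball x₀ χ.rIn
    · have hgf := cutoff_eventuallyEq f hin
      rw [frameDeriv_congr hgf, hgf.self_of_nhds]
      exact hle p hout
    · have hfp : f p = 0 := by
        by_contra h
        exact hpA ⟨⟨hout, hin⟩, h⟩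
      have hLfp : frameDeriv v c f p = 0 := by simpa [hfp] using hle p hout
      simp [cutoff, frameDeriv_mul (contDiff_ofReal χ.contDiff) hf, hfp, hLfp]
  · have hsupp : p ∉ tsupport (cutoff χ f) := fun h => hout (tsupport_cutoff_subset χ f h)
    simp [frameDeriv_eq_zero_of_notMem_tsupport hsupp, image_eq_zero_of_notMem_tsupport hsupp]

variable [MeasurableSpace E] [BorelSpace E] (μ : Measure E)
  [μ.IsAddHaarMeasure]

theorem carleman_weight_inequality (hc : ∀ i, ContDiff ℝ ∞ (c i)) (hφ : ContDiff ℝ ∞ φ)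
    (hg : ContDiff ℝ ∞ g) (hcg : HasCompactSupport g)
    (hcomm : ∀ p, g p ≠ 0 → ∀ i,
      frameDeriv v c (star (c i)) p = frameDeriv v (star c) (c i) p)
    {M : ℝ} (hdiv : ∀ p, g p ≠ 0 → -M ≤ (frameDeriv v c (frameDiv v (star c)) p).re)
    (hconv : ∀ p, g p ≠ 0 →
      1 ≤ (frameDeriv v (star c) (frameDeriv v c fun p => (φ p : ℂ)) p).re)
    {τ : ℝ} (hτ : 0 ≤ τ) :
    (2 * τ - M) * ∫ p, Real.exp (2 * τ * φ p) * ‖g p‖ ^ 2 ∂μ ≤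
      ∫ p, Real.exp (2 * τ * φ p) * ‖frameDeriv v c g p‖ ^ 2 ∂μ := by
  set Lφ := frameDeriv v c fun p => (φ p : ℂ) with hLφ
  have sLφ : ContDiff ℝ ∞ Lφ := contDiff_frameDeriv hc (contDiff_ofReal hφ)
  have sτφ : ContDiff ℝ ∞ (τ • φ) := hφ.const_smul τ
  set e : E → ℂ := fun p => (Real.exp ((τ • φ) p) : ℂ) with he
  have se : ContDiff ℝ ∞ e := contDiff_ofReal sτφ.exp
  have sa : ContDiff ℝ ∞ ((-τ) • Lφ) := sLφ.const_smul (-τ)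
  have seg : ContDiff ℝ ∞ (e * g) := se.mul hg
  have norm_e (p : E) (z : ℂ) : ‖e p * z‖ ^ 2 = Real.exp (2 * τ * φ p) * ‖z‖ ^ 2 := by
    rw [norm_mul, mul_pow, he, Complex.norm_real, Real.norm_of_nonneg (Real.exp_pos _).le,
      ← Real.exp_nat_mul, Pi.smul_apply, smul_eq_mul, Nat.cast_ofNat, mul_assoc]
  have cast : (fun p => ((τ • φ) p : ℂ)) = τ • fun p => (φ p : ℂ) := by
    funext p
    simp
  have conjugated : firstOrderOp v c ((-τ) • Lφ) (e * g) = e * frameDeriv v c g := by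
    rw [firstOrderOp, frameDeriv_mul se hg, he, frameDeriv_ofReal_exp sτφ, cast,
      frameDeriv_smul, ← hLφ]
    funext p
    simp only [Pi.add_apply, Pi.mul_apply, Pi.smul_apply, Complex.real_smul, Complex.ofReal_neg]
    ring
  have key := carleman_inequality μ hc sa seg hcg.mul_left
    (fun p hp => hcomm p (right_ne_zero_of_mul hp)) (A := 2 * τ - M) (fun p hp => by
      have hgp : g p ≠ 0 := right_ne_zero_of_mul hp
      rw [re_carlemanCoeff_weight hc hφ]
      nlinarith [hdiv p hgp, hconv p hgp])
  rw [conjugated] at key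
  simpa only [Pi.mul_apply, norm_e] using key

theorem integral_exp_mul_frameDeriv_cutoff_le (hc : ∀ i, ContDiff ℝ ∞ (c i))
    (hf : ContDiff ℝ ∞ f) (hφ : Continuous φ) (χ : ContDiffBump x₀) {C D : ℝ} (hD0 : 0 ≤ D)
    (hD : ∀ p, ‖frameDeriv v c (cutoff χ f) p‖ ^ 2 ≤ C ^ 2 * ‖cutoff χ f p‖ ^ 2 +
      ((Metric.closedBall x₀ χ.rOut \ Metric.ball x₀ χ.rIn) ∩ {q | f q ≠ 0}).indicator
        (fun _ => D) p)
    (hneg : ∀ p ∈ Metric.closedBall x₀ χ.rOut, f p ≠ 0 → φ p ≤ -‖p - x₀‖ ^ 2)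
    {τ : ℝ} (hτ : 0 ≤ τ) :
    ∫ p, Real.exp (2 * τ * φ p) * ‖frameDeriv v c (cutoff χ f) p‖ ^ 2 ∂μ ≤
      C ^ 2 * ∫ p, Real.exp (2 * τ * φ p) * ‖cutoff χ f p‖ ^ 2 ∂μ +
        D * μ.real (Metric.closedBall x₀ χ.rOut) * Real.exp (-2 * τ * χ.rIn ^ 2) := by
  set B := Metric.closedBall x₀ χ.rOut
  set g := cutoff χ f
  have sg : ContDiff ℝ ∞ g := contDiff_cutoff hf χ
  have hcg : HasCompactSupport g := hasCompactSupport_cutoff χ f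
  have hexp : Continuous fun p => Real.exp (2 * τ * φ p) := by fun_prop
  have intg : Integrable (fun p => Real.exp (2 * τ * φ p) * ‖g p‖ ^ 2) μ :=
    (hexp.mul (sg.continuous.norm.pow 2)).integrable_of_hasCompactSupport
      (hasCompactSupport_normSq hcg).mul_left
  have intLg : Integrable (fun p => Real.exp (2 * τ * φ p) * ‖frameDeriv v c g p‖ ^ 2) μ :=
    (hexp.mul ((contDiff_frameDeriv hc sg).continuous.norm.pow 2)).integrable_of_hasCompactSupport
      (hasCompactSupport_normSq (hasCompactSupport_frameDeriv hcg)).mul_left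
  have hB : MeasurableSet B := measurableSet_closedBall
  have intB : Integrable (B.indicator fun _ => D * Real.exp (-2 * τ * χ.rIn ^ 2)) μ :=
    (integrable_indicator_iff hB).2
      (integrableOn_const measure_closedBall_lt_top.ne)
  have pointwise (p : E) : Real.exp (2 * τ * φ p) * ‖frameDeriv v c g p‖ ^ 2 ≤
      C ^ 2 * (Real.exp (2 * τ * φ p) * ‖g p‖ ^ 2) +
        B.indicator (fun _ => D * Real.exp (-2 * τ * χ.rIn ^ 2)) p := by
    refine (mul_le_mul_of_nonneg_left (hD p) (Real.exp_pos _).le).trans ?_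
    rw [mul_add, mul_left_comm]
    gcongr
    by_cases hp : p ∈ (B \ Metric.ball x₀ χ.rIn) ∩ {q | f q ≠ 0}
    · have hκ : φ p ≤ -χ.rIn ^ 2 := (hneg p hp.1.1 hp.2).trans (neg_le_neg
        (pow_le_pow_left₀ χ.rIn_pos.le (by simpa [dist_eq_norm] using hp.1.2) 2))
      rw [Set.indicator_of_mem hp, Set.indicator_of_mem hp.1.1, mul_comm]
      exact mul_le_mul_of_nonneg_left
        (Real.exp_le_exp.2 (by nlinarith [mul_le_mul_of_nonneg_left hκ hτ])) hD0
    · rw [Set.indicator_of_notMem hp, mul_zero]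
      exact Set.indicator_nonneg (fun _ _ => by positivity) p
  refine (integral_mono intLg ((intg.const_mul (C ^ 2)).add intB) pointwise).trans_eq ?_
  simp only [Pi.add_apply]
  rw [integral_add (intg.const_mul _) intB, integral_const_mul,
    integral_indicator hB, setIntegral_const, smul_eq_mul]
  ring

theorem eventually_integral_exp_mul_cutoff_le (hc : ∀ i, ContDiff ℝ ∞ (c i))
    (hf : ContDiff ℝ ∞ f) (hφ : ContDiff ℝ ∞ φ) (χ : ContDiffBump x₀) {C : ℝ}
    (hcomm : ∀ p ∈ Metric.closedBall x₀ χ.rOut, ∀ i,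
      frameDeriv v c (star (c i)) p = frameDeriv v (star c) (c i) p)
    (hle : ∀ p ∈ Metric.closedBall x₀ χ.rOut, ‖frameDeriv v c f p‖ ≤ C * ‖f p‖)
    (hconv : ∀ p ∈ Metric.closedBall x₀ χ.rOut,
      1 ≤ (frameDeriv v (star c) (frameDeriv v c fun p => (φ p : ℂ)) p).re)
    (hneg : ∀ p ∈ Metric.closedBall x₀ χ.rOut, f p ≠ 0 → φ p ≤ -‖p - x₀‖ ^ 2) :
    ∃ A, ∀ᶠ τ in atTop,
      ∫ p, Real.exp (2 * τ * φ p) * ‖cutoff χ f p‖ ^ 2 ∂μ ≤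
        A * Real.exp (-2 * τ * χ.rIn ^ 2) := by
  have mem_ball (p : E) (hp : cutoff χ f p ≠ 0) : p ∈ Metric.closedBall x₀ χ.rOut :=
    tsupport_cutoff_subset χ f (subset_tsupport _ hp)
  obtain ⟨M, hM⟩ : ∃ M, ∀ p ∈ Metric.closedBall x₀ χ.rOut,
      ‖frameDeriv v c (frameDiv v (star c)) p‖ ≤ M :=
    (isCompact_closedBall x₀ χ.rOut).exists_bound_of_continuousOn (contDiff_frameDeriv hc
      (contDiff_frameDiv fun i => contDiff_star (hc i))).continuous.continuousOn
  obtain ⟨D, hD0, hD⟩ := exists_cutoff_bound hc hf χ hle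
  refine ⟨D * μ.real (Metric.closedBall x₀ χ.rOut), ?_⟩
  -- For such `τ` the Carleman inequality absorbs the term with the factor `C ^ 2`.
  filter_upwards [eventually_ge_atTop 0, eventually_ge_atTop ((M + C ^ 2 + 1) / 2)] with τ hτ hτM
  have lower := carleman_weight_inequality μ hc hφ (contDiff_cutoff hf χ)
    (hasCompactSupport_cutoff χ f) (fun p hp => hcomm p (mem_ball p hp))
    (fun p hp => neg_le_of_abs_le ((Complex.abs_re_le_norm _).trans (hM p (mem_ball p hp))))
    (fun p hp => hconv p (mem_ball p hp)) hτ
  have upper := integral_exp_mul_frameDeriv_cutoff_le μ hc hf hφ.continuous χ hD0 hD hneg hτ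
  have nonneg : 0 ≤ ∫ p, Real.exp (2 * τ * φ p) * ‖cutoff χ f p‖ ^ 2 ∂μ :=
    integral_nonneg fun p => by positivity
  nlinarith

omit [MeasurableSpace E] [BorelSpace E] in
theorem eventually_eq_zero_of_norm_frameDeriv_le (hc : ∀ i, ContDiff ℝ ∞ (c i))
    (hf : ContDiff ℝ ∞ f) (hφ : ContDiff ℝ ∞ φ) {C : ℝ}
    (hcomm : ∀ᶠ p in 𝓝 x₀, ∀ i,
      frameDeriv v c (star (c i)) p = frameDeriv v (star c) (c i) p)
    (hle : ∀ᶠ p in 𝓝 x₀, ‖frameDeriv v c f p‖ ≤ C * ‖f p‖) (hφ0 : φ x₀ = 0)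
    (hconv : ∀ᶠ p in 𝓝 x₀,
      1 ≤ (frameDeriv v (star c) (frameDeriv v c fun p => (φ p : ℂ)) p).re)
    (hneg : ∀ᶠ p in 𝓝 x₀, f p ≠ 0 → φ p ≤ -‖p - x₀‖ ^ 2) :
    ∀ᶠ p in 𝓝 x₀, f p = 0 := by
  borelize E
  obtain ⟨ε, hε, hball⟩ := Metric.eventually_nhds_iff_ball.1
    (hcomm.and (hle.and (hconv.and hneg)))
  let χ : ContDiffBump x₀ := ⟨ε / 3, ε / 2, by positivity, by linarith⟩
  have hsub : Metric.closedBall x₀ χ.rOut ⊆ Metric.ball x₀ ε :=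
    Metric.closedBall_subset_ball (half_lt_self hε)
  obtain ⟨A, hA⟩ := eventually_integral_exp_mul_cutoff_le Measure.addHaar hc hf hφ χ
    (fun p hp => (hball p (hsub hp)).1) (fun p hp => (hball p (hsub hp)).2.1)
    (fun p hp => (hball p (hsub hp)).2.2.1) (fun p hp => (hball p (hsub hp)).2.2.2)
  have hφx : -χ.rIn ^ 2 < φ x₀ := by
    rw [hφ0]
    exact neg_lt_zero.2 (pow_pos χ.rIn_pos 2)
  filter_upwards [hφ.continuous.continuousAt.eventually (lt_mem_nhds hφx),
    cutoff_eventuallyEq f (Metric.mem_ball_self χ.rIn_pos)] with p hp hgf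
  have hgp : ‖cutoff χ f p‖ ^ 2 = 0 := eq_zero_of_integral_exp_le hφ.continuous
    ((contDiff_cutoff hf χ).continuous.norm.pow 2)
    (hasCompactSupport_normSq (hasCompactSupport_cutoff χ f)) (fun _ => sq_nonneg _) hA hp
  simpa [hgf] using hgp

end UniqueContinuation

section Noncharacteristic

variable {E ι : Type*} [NormedAddCommGroup E] [NormedSpace ℝ E] [Fintype ι]
  {v : ι → E} {c : ι → E → ℂ} {f : E → ℂ} {y : E → ℝ}

theorem frameDeriv_star_ofReal (hy : ContDiff ℝ ∞ y) :
    (frameDeriv v (star c) fun p => (y p : ℂ)) = star (frameDeriv v c fun p => (y p : ℂ)) := by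
  rw [← frameDeriv_star (contDiff_ofReal hy)]
  congr 1
  ext p
  simp

theorem frameDeriv_frameDeriv_mul_self {x₀ : E} (hc : ∀ i, ContDiff ℝ ∞ (c i))
    (hy : ContDiff ℝ ∞ y) (hy0 : y x₀ = 0) :
    frameDeriv v (star c) (frameDeriv v c ((fun p => (y p : ℂ)) * fun p => (y p : ℂ))) x₀ =
      ((2 * ‖frameDeriv v c (fun p => (y p : ℂ)) x₀‖ ^ 2 : ℝ) : ℂ) := by
  have hY := contDiff_ofReal hy
  have hLY := contDiff_frameDeriv (v := v) hc hY
  have s₁ : ContDiff ℝ ∞ ((frameDeriv v c fun p => (y p : ℂ)) * fun p => (y p : ℂ)) := hLY.mul hY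
  have s₂ : ContDiff ℝ ∞ ((fun p => (y p : ℂ)) * frameDeriv v c fun p => (y p : ℂ)) := hY.mul hLY
  rw [frameDeriv_mul hY hY, frameDeriv_add s₁ s₂, frameDeriv_mul hLY hY, frameDeriv_mul hY hLY,
    frameDeriv_star_ofReal hy]
  simp only [Pi.add_apply, Pi.mul_apply, Pi.star_apply, hy0, Complex.ofReal_zero, mul_zero,
    zero_mul, zero_add, add_zero, RCLike.star_def, Complex.mul_conj', Complex.conj_mul']
  push_cast
  ring

variable [FiniteDimensional ℝ E] {x₀ : E}

theorem exists_contDiff_norm_sub_sq_le (x₀ : E) :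
    ∃ q : E → ℝ, ContDiff ℝ ∞ q ∧ q x₀ = 0 ∧ ∀ p, ‖p - x₀‖ ^ 2 ≤ q p := by
  let T : E ≃L[ℝ] EuclideanSpace ℝ (Fin (Module.finrank ℝ E)) := toEuclidean
  let K := ‖(T.symm : EuclideanSpace ℝ (Fin (Module.finrank ℝ E)) →L[ℝ] E)‖
  refine ⟨fun p => (K * ‖T (p - x₀)‖) ^ 2, ?_, by simp, fun p => ?_⟩
  · simp only [mul_pow]
    exact contDiff_const.mul ((T.contDiff.comp (contDiff_id.sub contDiff_const)).norm_sq ℝ)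
  · refine pow_le_pow_left₀ (norm_nonneg _) ?_ 2
    simpa using ContinuousLinearMap.le_opNorm (T.symm : _ →L[ℝ] E) (T (p - x₀))

theorem exists_convex_weight (hc : ∀ i, ContDiff ℝ ∞ (c i)) (hy : ContDiff ℝ ∞ y)
    (hy0 : y x₀ = 0) (hLy : frameDeriv v c (fun p => (y p : ℂ)) x₀ ≠ 0) :
    ∃ φ : E → ℝ, ContDiff ℝ ∞ φ ∧ φ x₀ = 0 ∧
      (∀ᶠ p in 𝓝 x₀, 1 ≤ (frameDeriv v (star c) (frameDeriv v c fun p => (φ p : ℂ)) p).re) ∧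
      ∀ᶠ p in 𝓝 x₀, y p < 0 → φ p ≤ -‖p - x₀‖ ^ 2 := by
  obtain ⟨q, hq, hq0, hle_q⟩ := exists_contDiff_norm_sub_sq_le x₀
  let Y : E → ℂ := fun p => (y p : ℂ)
  let Q : E → ℂ := fun p => (q p : ℂ)
  have hYY : ContDiff ℝ ∞ (Y * Y) := (contDiff_ofReal hy).mul (contDiff_ofReal hy)
  have hYQ : ContDiff ℝ ∞ (Y + (-1 : ℝ) • Q) :=
    (contDiff_ofReal hy).add ((contDiff_ofReal hq).const_smul (-1 : ℝ))
  have sYY (a : ℝ) : ContDiff ℝ ∞ (a • (Y * Y)) := hYY.const_smul a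
  have sLYY (a : ℝ) : ContDiff ℝ ∞ (a • frameDeriv v c (Y * Y)) :=
    (contDiff_frameDeriv hc hYY).const_smul a
  let B := (frameDeriv v (star c) (frameDeriv v c (Y + (-1 : ℝ) • Q)) x₀).re
  let A := (2 - B) / (2 * ‖frameDeriv v c Y x₀‖ ^ 2)
  -- The square of `y` makes the weight strictly convex along the field, while `q` makes its
  -- superlevel sets on the side `y < 0` shrink to `x₀`.
  let φ : E → ℝ := fun p => y p - q p + A * y p ^ 2
  have hφ : ContDiff ℝ ∞ φ := (hy.sub hq).add (contDiff_const.mul (hy.pow 2))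
  have hφ_eq : (fun p => (φ p : ℂ)) = Y + (-1 : ℝ) • Q + A • (Y * Y) := by
    ext p
    simp only [φ, Y, Q, Pi.add_apply, Pi.smul_apply, Pi.mul_apply, Complex.real_smul]
    push_cast
    ring
  have hconv : (frameDeriv v (star c) (frameDeriv v c fun p => (φ p : ℂ)) x₀).re = 2 := by
    have hL : ‖frameDeriv v c Y x₀‖ ≠ 0 := norm_ne_zero_iff.2 hLy
    rw [hφ_eq, frameDeriv_add hYQ (sYY A), frameDeriv_smul,
      frameDeriv_add (contDiff_frameDeriv hc hYQ) (sLYY A),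
      frameDeriv_smul, Pi.add_apply, Pi.smul_apply, frameDeriv_frameDeriv_mul_self hc hy hy0,
      Complex.add_re, Complex.real_smul, ← Complex.ofReal_mul, Complex.ofReal_re]
    change B + A * _ = 2
    simp only [A]
    field_simp
    ring
  have hcont : Continuous (frameDeriv v (star c) (frameDeriv v c fun p => (φ p : ℂ))) :=
    (contDiff_frameDeriv (fun i => contDiff_star (hc i))
      (contDiff_frameDeriv hc (contDiff_ofReal hφ))).continuous
  have hsmall : ∀ᶠ p in 𝓝 x₀, -1 < A * y p :=
    ((continuous_const.mul hy.continuous).tendsto x₀).eventually_const_lt (by simp [hy0])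
  refine ⟨φ, hφ, by simp [φ, hy0, hq0],
    ((Complex.continuous_re.comp hcont).tendsto x₀).eventually_const_le
      (one_lt_two.trans_eq hconv.symm), hsmall.mono fun p hA hyp => ?_⟩
  simp only [φ]
  nlinarith [hle_q p]

theorem eventually_eq_zero_of_noncharacteristic_side (hc : ∀ i, ContDiff ℝ ∞ (c i))
    (hf : ContDiff ℝ ∞ f) (hy : ContDiff ℝ ∞ y) {C : ℝ}
    (hcomm : ∀ᶠ p in 𝓝 x₀, ∀ i,
      frameDeriv v c (star (c i)) p = frameDeriv v (star c) (c i) p)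
    (hle : ∀ᶠ p in 𝓝 x₀, ‖frameDeriv v c f p‖ ≤ C * ‖f p‖) (hy0 : y x₀ = 0)
    (hLy : frameDeriv v c (fun p => (y p : ℂ)) x₀ ≠ 0)
    (hside : ∀ᶠ p in 𝓝 x₀, 0 ≤ y p → f p = 0) : ∀ᶠ p in 𝓝 x₀, f p = 0 := by
  obtain ⟨φ, hφ, hφ0, hconv, hneg⟩ := exists_convex_weight hc hy hy0 hLy
  refine eventually_eq_zero_of_norm_frameDeriv_le hc hf hφ hcomm hle hφ0 hconv ?_
  filter_upwards [hside, hneg] with p hp hφp hfp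
  exact hφp (not_le.1 fun h => hfp (hp h))

end Noncharacteristic

section CROperator

variable {E : Type*} [NormedAddCommGroup E] [NormedSpace ℝ E] {v : Fin 3 → E}
  {b b' f f' r r' : E → ℂ}

/-- The coefficients of the vector field `∂_{v 0} + i ∂_{v 1} + b̄ ∂_{v 2}`. -/
noncomputable def crCoeff (b : E → ℂ) : Fin 3 → E → ℂ := ![1, fun _ => Complex.I, star b]

/-- The tangential Cauchy–Riemann operator `∂_{v 0} + i ∂_{v 1} + b̄ ∂_{v 2}` with slope `b`. On a
graph over a real hyperplane, `v 0 + i v 1` is a `(0, 1)`-direction in the base, and adding `b̄`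
times the transversal direction `v 2` makes it tangent to the graph. -/
noncomputable def crOp (v : Fin 3 → E) (b f : E → ℂ) : E → ℂ := frameDeriv v (crCoeff b) f

theorem crOp_eq (v : Fin 3 → E) (b f : E → ℂ) :
    crOp v b f =
      dirDeriv (v 0) f + (fun _ => Complex.I) * dirDeriv (v 1) f + star b * dirDeriv (v 2) f := by
  simp [crOp, crCoeff, frameDeriv, Fin.sum_univ_three]

theorem contDiff_crCoeff (hb : ContDiff ℝ ∞ b) : ∀ i, ContDiff ℝ ∞ (crCoeff b i)
  | 0 => contDiff_const
  | 1 => contDiff_const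
  | 2 => contDiff_star hb

theorem contDiff_crOp (hb : ContDiff ℝ ∞ b) (hf : ContDiff ℝ ∞ f) : ContDiff ℝ ∞ (crOp v b f) :=
  contDiff_frameDeriv (contDiff_crCoeff hb) hf

theorem crOp_sub (hf : ContDiff ℝ ∞ f) (hf' : ContDiff ℝ ∞ f') :
    crOp v b (f - f') = crOp v b f - crOp v b' f' - star (b - b') * dirDeriv (v 2) f' := by
  have hsub (u : E) : dirDeriv u (f - f') = dirDeriv u f - dirDeriv u f' := by
    ext p
    exact congrArg (· u) (fderiv_sub (differentiableAt_of_smooth hf p)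
      (differentiableAt_of_smooth hf' p))
  simp only [crOp_eq, hsub, star_sub]
  ring

theorem frameDeriv_crCoeff_comm (hb : ContDiff ℝ ∞ b) {p : E} (h : crOp v b b p = 0) :
    ∀ i, frameDeriv v (crCoeff b) (star (crCoeff b i)) p =
      frameDeriv v (star (crCoeff b)) (crCoeff b i) p := by
  have hconst (c : Fin 3 → E → ℂ) (z : ℂ) : frameDeriv v c (fun _ => z) p = 0 := by
    simp [frameDeriv, dirDeriv]
  have hstar : frameDeriv v (star (crCoeff b)) (star b) p = star (crOp v b b p) :=
    congrFun (frameDeriv_star hb) p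
  intro i
  match i with
  | 0 => exact (hconst _ (star 1)).trans (hconst _ 1).symm
  | 1 => exact (hconst _ (star Complex.I)).trans (hconst _ Complex.I).symm
  | 2 =>
    change frameDeriv v (crCoeff b) (star (star b)) p = frameDeriv v (star (crCoeff b)) (star b) p
    rw [hstar, star_star, h, star_zero]
    exact h

section InfiniteOrder

variable {C : Set E} {y : E →L[ℝ] ℝ}

theorem VanishTo.of_crOp (hC : IsOpen C) (hy0 : y (v 0) = 0) (hy1 : y (v 1) = 1)
    (hy2 : y (v 2) = 0) (hb : ContDiff ℝ ∞ b) (hf : ContDiff ℝ ∞ f)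
    (h0 : ∀ p ∈ C ∩ {p | y p = 0}, f p = 0)
    (h : ∀ n, VanishTo (C ∩ {p | y p = 0}) n f → VanishTo (C ∩ {p | y p = 0}) n (crOp v b f))
    (n : ℕ) : VanishTo (C ∩ {p | y p = 0}) n f := by
  induction n with
  | zero => trivial
  | succ n ih =>
    have hI : ContDiff ℝ ∞ fun _ : E => -Complex.I := contDiff_const
    have s0 := contDiff_dirDeriv hf (v 0)
    have s2 : ContDiff ℝ ∞ (star b * dirDeriv (v 2) f) :=
      (contDiff_star hb).mul (contDiff_dirDeriv hf (v 2))
    have sop : ContDiff ℝ ∞ (crOp v b f) := contDiff_crOp hb hf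
    have hnormal : dirDeriv (v 1) f = (fun _ => -Complex.I) *
        (crOp v b f - (dirDeriv (v 0) f + star b * dirDeriv (v 2) f)) := by
      ext p
      simp only [crOp_eq, Pi.add_apply, Pi.sub_apply, Pi.mul_apply, Pi.star_apply]
      linear_combination dirDeriv (v 1) f p * Complex.I_mul_I
    refine VanishTo.succ_of_normal hC hy1 hf h0 ?_
    rw [hnormal]
    exact VanishTo.mul_left hI (sop.sub (s0.add s2)) <| (h n ih).sub sop (s0.add s2) <|
      (ih.dirDeriv_tangent hC hf hy0).add s0 s2 <|
        (ih.dirDeriv_tangent hC hf hy2).mul_left (contDiff_star hb) (contDiff_dirDeriv hf _)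

theorem vanishTo_sub_of_crOp (hC : IsOpen C) (hy0 : y (v 0) = 0) (hy1 : y (v 1) = 1)
    (hy2 : y (v 2) = 0) (sb : ContDiff ℝ ∞ b) (sb' : ContDiff ℝ ∞ b') (sr : ContDiff ℝ ∞ r)
    (sr' : ContDiff ℝ ∞ r') (hb : ∀ n, VanishTo (C ∩ {p | y p = 0}) n (crOp v b b))
    (hb' : ∀ n, VanishTo (C ∩ {p | y p = 0}) n (crOp v b' b'))
    (hr : crOp v b r = (fun _ => Complex.I) * star b)
    (hr' : crOp v b' r' = (fun _ => Complex.I) * star b')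
    (hbb' : ∀ p ∈ C ∩ {p | y p = 0}, b p = b' p) (hrr' : ∀ p ∈ C ∩ {p | y p = 0}, r p = r' p)
    (n : ℕ) : VanishTo (C ∩ {p | y p = 0}) n (r - r') := by
  have sδ : ContDiff ℝ ∞ (b - b') := sb.sub sb'
  have hmul {n : ℕ} {g : E → ℂ} (hg : ContDiff ℝ ∞ g)
      (h : VanishTo (C ∩ {p | y p = 0}) n (b - b')) :
      VanishTo (C ∩ {p | y p = 0}) n (star (b - b') * g) := by
    rw [mul_comm]
    exact (h.conj sδ).mul_left hg (contDiff_star sδ)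
  have smul {g : E → ℂ} (hg : ContDiff ℝ ∞ g) : ContDiff ℝ ∞ (star (b - b') * g) :=
    (contDiff_star sδ).mul hg
  have hδ : ∀ n, VanishTo (C ∩ {p | y p = 0}) n (b - b') :=
    VanishTo.of_crOp hC hy0 hy1 hy2 sb sδ (fun p hp => sub_eq_zero.2 (hbb' p hp)) fun n hn => by
      rw [crOp_sub (b' := b') sb sb']
      exact ((hb n).sub (contDiff_crOp sb sb) (contDiff_crOp sb' sb') (hb' n)).sub
        ((contDiff_crOp sb sb).sub (contDiff_crOp sb' sb')) (smul (contDiff_dirDeriv sb' _))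
        (hmul (contDiff_dirDeriv sb' _) hn)
  have hsub : crOp v b (r - r') = star (b - b') * ((fun _ => Complex.I) - dirDeriv (v 2) r') := by
    rw [crOp_sub (b' := b') sr sr', hr, hr', star_sub]
    ring
  refine VanishTo.of_crOp (f := r - r') hC hy0 hy1 hy2 sb (sr.sub sr')
    (fun p hp => sub_eq_zero.2 (hrr' p hp)) (fun n _ => ?_) n
  rw [hsub]
  exact hmul (contDiff_const.sub (contDiff_dirDeriv sr' _)) (hδ n)

end InfiniteOrder

theorem eventually_eq_of_crOp [FiniteDimensional ℝ E] {x₀ : E} {y : E → ℝ}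
    (sb : ContDiff ℝ ∞ b) (sb' : ContDiff ℝ ∞ b') (sr : ContDiff ℝ ∞ r) (sr' : ContDiff ℝ ∞ r')
    (hb : ∀ᶠ p in 𝓝 x₀, crOp v b b p = 0) (hb' : ∀ᶠ p in 𝓝 x₀, crOp v b' b' p = 0)
    (hr : crOp v b r = (fun _ => Complex.I) * star b)
    (hr' : crOp v b' r' = (fun _ => Complex.I) * star b')
    (hy : ContDiff ℝ ∞ y) (hy0 : y x₀ = 0) (hLy : crOp v b (fun p => (y p : ℂ)) x₀ ≠ 0)
    (hbb' : ∀ᶠ p in 𝓝 x₀, 0 ≤ y p → b p = b' p)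
    (hrr' : ∀ᶠ p in 𝓝 x₀, 0 ≤ y p → r p = r' p) : ∀ᶠ p in 𝓝 x₀, r p = r' p := by
  have hcomm := hb.mono fun p hp => frameDeriv_crCoeff_comm sb hp
  have hbound : ∀ᶠ p in 𝓝 x₀, ‖dirDeriv (v 2) b' p‖ ≤ ‖dirDeriv (v 2) b' x₀‖ + 1 :=
    ((contDiff_dirDeriv sb' _).continuous.norm.tendsto x₀).eventually_le_const (lt_add_one _)
  have slopes : ∀ᶠ p in 𝓝 x₀, (b - b') p = 0 := by
    refine eventually_eq_zero_of_noncharacteristic_side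
      (C := ‖dirDeriv (v 2) b' x₀‖ + 1) (contDiff_crCoeff sb) (sb.sub sb') hy
      hcomm ?_ hy0 hLy (hbb'.mono fun p h hp => sub_eq_zero.2 (h hp))
    filter_upwards [hb, hb', hbound] with p h h' hD
    change ‖crOp v b (b - b') p‖ ≤ _
    rw [crOp_sub (b' := b') sb sb']
    simp only [Pi.sub_apply, Pi.mul_apply, Pi.star_apply, h, h', sub_self, zero_sub, norm_neg,
      norm_mul, norm_star]
    rw [mul_comm]
    gcongr
  refine (eventually_eq_zero_of_noncharacteristic_side (C := 0) (contDiff_crCoeff sb)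
    (sr.sub sr') hy hcomm ?_ hy0 hLy (hrr'.mono fun p h hp => sub_eq_zero.2 (h hp))).mono
    fun p hp => sub_eq_zero.1 hp
  filter_upwards [slopes] with p hp
  change ‖crOp v b (r - r') p‖ ≤ _
  have hbp : b p = b' p := sub_eq_zero.1 hp
  rw [crOp_sub (b' := b') sr sr', hr, hr']
  simp [hbp]

end CROperator

section Graph

theorem exists_contDiff_eventuallyEq {E : Type*} [NormedAddCommGroup E] [NormedSpace ℝ E]
    [FiniteDimensional ℝ E] {f : E → ℝ} {U : Set E} {x : E} (hU : U ∈ 𝓝 x)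
    (hf : ContDiffOn ℝ ∞ f U) : ∃ g : E → ℝ, ContDiff ℝ ∞ g ∧ g =ᶠ[𝓝 x] f := by
  obtain ⟨ε, hε, hball⟩ := Metric.mem_nhds_iff.1 hU
  let χ : ContDiffBump x := ⟨ε / 3, ε / 2, by positivity, by linarith⟩
  refine ⟨χ * f, contDiff_iff_contDiffAt.2 fun p => ?_, ?_⟩
  · by_cases hp : p ∈ Metric.ball x ε
    · exact χ.contDiff.contDiffAt.mul
        ((hf.mono hball).contDiffAt (Metric.isOpen_ball.mem_nhds hp))
    · have hsupp : p ∉ tsupport χ := by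
        rw [χ.tsupport_eq, Metric.mem_closedBall]
        rw [Metric.mem_ball] at hp
        change ¬ dist p x ≤ ε / 2
        linarith
      refine (contDiffAt_const (c := (0 : ℝ))).congr_of_eventuallyEq ?_
      filter_upwards [notMem_tsupport_iff_eventuallyEq.1 hsupp] with q hq
      simp [hq]
  · filter_upwards [χ.eventuallyEq_one] with q hq
    simp [hq]

theorem exists_openPartialHomeomorph_of_hasFDerivAt {E F : Type*} [NormedAddCommGroup E]
    [NormedSpace ℝ E] [CompleteSpace E] [NormedAddCommGroup F] [NormedSpace ℝ F]
    {f : E → F} (hf : ContDiff ℝ ∞ f) {x : E} {A : E ≃L[ℝ] F}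
    (hA : HasFDerivAt f (A : E →L[ℝ] F) x) :
    ∃ e : OpenPartialHomeomorph E F, x ∈ e.source ∧ ⇑e = f ∧
      ∃ T ∈ 𝓝 (f x), ContDiffOn ℝ ∞ e.symm T := by
  let e := hf.contDiffAt.toOpenPartialHomeomorph f hA (by simp)
  have hxe : x ∈ e.source := hf.contDiffAt.mem_toOpenPartialHomeomorph_source hA (by simp)
  have hinv : ∀ᶠ p in 𝓝 x, fderiv ℝ f p ∈ Set.range ((↑) : (E ≃L[ℝ] F) → E →L[ℝ] F) := by
    refine (hf.continuous_fderiv (by simp)).continuousAt.eventually_mem ?_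
    rw [hA.fderiv]
    exact ContinuousLinearEquiv.nhds A
  have hsymm : ∀ᶠ q in 𝓝 (f x), q ∈ e.target ∧
      fderiv ℝ f (e.symm q) ∈ Set.range ((↑) : (E ≃L[ℝ] F) → E →L[ℝ] F) :=
    (e.open_target.eventually_mem (e.map_source hxe)).and ((e.tendsto_symm hxe).eventually hinv)
  refine ⟨e, hxe, rfl, _, hsymm, fun q ⟨hqt, B, hB⟩ => ?_⟩
  have hderiv : HasFDerivAt f (B : E →L[ℝ] F) (e.symm q) :=
    hB ▸ (hf.differentiable (by simp) _).hasFDerivAt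
  exact (e.contDiffAt_symm hqt hderiv hf.contDiffAt).contDiffWithinAt

variable {N : ℕ} (k : Fin N)

/-- The `k`-th imaginary coordinate direction of `ℂ^N`. -/
noncomputable abbrev imDir : Fin N → ℂ := Pi.single k Complex.I

/-- The `k`-th real coordinate direction of `ℂ^N`. -/
noncomputable abbrev reDir : Fin N → ℂ := Pi.single k 1

/-- The function `p ↦ Im p_k`. -/
noncomputable def imCoord : (Fin N → ℂ) →L[ℝ] ℝ :=
  Complex.imCLM.comp (ContinuousLinearMap.proj (R := ℝ) (φ := fun _ : Fin N => ℂ) k)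

theorem imCoord_apply (p : Fin N → ℂ) : imCoord k p = (p k).im := rfl

/-- The projection of `ℂ^N` removing the imaginary part of the `k`-th coordinate. -/
noncomputable def flatten : (Fin N → ℂ) →L[ℝ] (Fin N → ℂ) :=
  ContinuousLinearMap.id ℝ _ - (imCoord k).smulRight (imDir k)

theorem flatten_apply (p : Fin N → ℂ) : flatten k p = p - (p k).im • imDir k := rfl

theorem flatten_imDir : flatten k (imDir k) = 0 := by
  simp [flatten_apply]

theorem flatten_apply_self_im (p : Fin N → ℂ) : (flatten k p k).im = 0 := by
  simp [flatten_apply]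

theorem flatten_apply_of_ne (p : Fin N → ℂ) {i : Fin N} (h : i ≠ k) : flatten k p i = p i := by
  simp [flatten_apply, h]

theorem flatten_flatten (p : Fin N → ℂ) : flatten k (flatten k p) = flatten k p := by
  rw [flatten_apply k (flatten k p), flatten_apply_self_im, zero_smul, sub_zero]

theorem flatten_add_smul (p : Fin N → ℂ) (t : ℝ) :
    flatten k (p + t • imDir k) = flatten k p := by
  simp [flatten_imDir]

/-- Smooth real functions on `ℂ^N` which do not depend on the imaginary part of the `k`-th
coordinate, and hence define the hypersurface `Im p_k = r p`. -/
structure IsGraphFun (r : (Fin N → ℂ) → ℝ) : Prop where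
  smooth : ContDiff ℝ ∞ r
  flat : ∀ p, r (flatten k p) = r p

/-- The map `p ↦ (p with Im p_k replaced by r p)`; when `r` does not depend on `Im p_k`, the
projection of `ℂ^N` onto the hypersurface `Im p_k = r p`. -/
noncomputable def graphPt (r : (Fin N → ℂ) → ℝ) (p : Fin N → ℂ) : Fin N → ℂ :=
  flatten k p + r p • imDir k

variable {k} {r : (Fin N → ℂ) → ℝ} {p : Fin N → ℂ}

theorem fderiv_imDir_of_flat {G : Type*} [NormedAddCommGroup G] [NormedSpace ℝ G]
    {f : (Fin N → ℂ) → G} (hf : ∀ p, f (flatten k p) = f p) (p : Fin N → ℂ) :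
    fderiv ℝ f p (imDir k) = 0 := by
  by_cases hd : DifferentiableAt ℝ f p
  · refine dirDeriv_eq_zero_of_eventually_eq (c := f p) hd (Eventually.of_forall fun t => ?_)
    rw [← hf, flatten_add_smul, hf]
  · rw [fderiv_zero_of_not_differentiableAt hd, zero_apply]

theorem fderiv_eq_of_flat {G : Type*} [NormedAddCommGroup G] [NormedSpace ℝ G]
    {f : (Fin N → ℂ) → G} (hf : ∀ p, f (flatten k p) = f p) {p q : Fin N → ℂ}
    (hpq : flatten k p = flatten k q) : fderiv ℝ f p = fderiv ℝ f q := by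
  set c : Fin N → ℂ := ((p k).im - (q k).im) • imDir k with hc
  have hp : p = q + c := by
    rw [flatten_apply, flatten_apply] at hpq
    rw [hc, sub_smul, ← add_sub_assoc, add_sub_right_comm, ← hpq, sub_add_cancel]
  have hshift : (fun x => f (x + c)) = f := by
    funext x
    rw [← hf, hc, flatten_add_smul, hf]
  rw [hp, ← fderiv_comp_add_right, hshift]

theorem flatten_graphPt (r : (Fin N → ℂ) → ℝ) (p : Fin N → ℂ) :
    flatten k (graphPt k r p) = flatten k p := by
  rw [graphPt, flatten_add_smul, flatten_flatten]

theorem graphPt_apply_im (r : (Fin N → ℂ) → ℝ) (p : Fin N → ℂ) :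
    (graphPt k r p k).im = r p := by
  simp [graphPt, flatten_apply_self_im]

theorem graphPt_apply_of_ne (r : (Fin N → ℂ) → ℝ) (p : Fin N → ℂ) {i : Fin N} (h : i ≠ k) :
    graphPt k r p i = p i := by
  simp [graphPt, flatten_apply_of_ne, h]

theorem graphPt_eq_self (h : (p k).im = r p) : graphPt k r p = p := by
  rw [graphPt, flatten_apply, h, sub_add_cancel]

theorem graphPt_zero (h0 : r 0 = 0) : graphPt k r 0 = 0 := by
  simp [graphPt, h0]

theorem graphPt_eq_flatten_iff : graphPt k r p = flatten k p ↔ r p = 0 := by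
  simp [graphPt]

theorem hasFDerivAt_graphPt (hr : DifferentiableAt ℝ r p) :
    HasFDerivAt (graphPt k r) (flatten k + (fderiv ℝ r p).smulRight (imDir k)) p :=
  (flatten k).hasFDerivAt.add (hr.hasFDerivAt.smul_const (imDir k))

namespace IsGraphFun

theorem apply_graphPt (hr : IsGraphFun k r) (s : (Fin N → ℂ) → ℝ) (p : Fin N → ℂ) :
    r (graphPt k s p) = r p := by
  rw [← hr.flat, flatten_graphPt, hr.flat]

theorem graphPt_mem (hr : IsGraphFun k r) (p : Fin N → ℂ) :
    (graphPt k r p k).im = r (graphPt k r p) := by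
  rw [graphPt_apply_im, hr.apply_graphPt]

theorem contDiff_graphPt (hr : IsGraphFun k r) : ContDiff ℝ ∞ (graphPt k r) :=
  (flatten k).contDiff.add (hr.smooth.smul contDiff_const)

theorem tendsto_graphPt (hr : IsGraphFun k r) (h0 : r 0 = 0) :
    Tendsto (graphPt k r) (𝓝 0) (𝓝 0) := by
  simpa only [graphPt_zero h0] using hr.contDiff_graphPt.continuous.tendsto 0

end IsGraphFun

theorem exists_coe_eq_flatten_add_smulRight {ℓ : (Fin N → ℂ) →L[ℝ] ℝ} (h : ℓ (imDir k) ≠ 0) :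
    ∃ A : (Fin N → ℂ) ≃L[ℝ] (Fin N → ℂ),
      (A : (Fin N → ℂ) →L[ℝ] (Fin N → ℂ)) = flatten k + ℓ.smulRight (imDir k) := by
  set A := flatten k + ℓ.smulRight (imDir k)
  have inj : Function.Injective A := by
    rw [injective_iff_map_eq_zero]
    intro v hv
    have hv : flatten k v + ℓ v • imDir k = 0 := hv
    have hflat : flatten k v = 0 := by
      rw [← flatten_flatten, ← flatten_add_smul k _ (ℓ v), hv, map_zero]
    have hℓ : ℓ v = 0 := by simpa [hflat] using hv
    have hvk : v = (v k).im • imDir k := sub_eq_zero.1 hflat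
    rw [hvk, map_smul, smul_eq_mul] at hℓ
    rw [hvk, (mul_eq_zero.1 hℓ).resolve_right h, zero_smul]
  exact ⟨(LinearEquiv.ofInjectiveEndo (A : (Fin N → ℂ) →ₗ[ℝ] (Fin N → ℂ))
    inj).toContinuousLinearEquiv, rfl⟩

theorem exists_graph_of_fderiv_ne_zero {ρ : (Fin N → ℂ) → ℝ} (hρ : ContDiff ℝ ∞ ρ)
    (h0 : ρ 0 = 0) (hk : fderiv ℝ ρ 0 (imDir k) ≠ 0) :
    ∃ r, IsGraphFun k r ∧ r 0 = 0 ∧ ∀ᶠ p in 𝓝 (0 : Fin N → ℂ), (ρ p = 0 ↔ (p k).im = r p) := by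
  obtain ⟨A, hA⟩ := exists_coe_eq_flatten_add_smulRight hk
  obtain ⟨e, h0e, he, T, hT, hsymm⟩ := exists_openPartialHomeomorph_of_hasFDerivAt
    ((flatten k).contDiff.add (hρ.smul contDiff_const))
    (hA ▸ hasFDerivAt_graphPt (hρ.differentiable (by simp) 0))
  change ⇑e = graphPt k ρ at he
  change T ∈ 𝓝 (graphPt k ρ 0) at hT
  have he0 : e 0 = 0 := by rw [he, graphPt_zero h0]
  have hs0 : e.symm 0 = 0 := by simpa only [he0] using e.left_inv h0e
  obtain ⟨g, sg, hg⟩ := exists_contDiff_eventuallyEq (f := fun q => (e.symm q k).im) hT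
    ((imCoord k).contDiff.comp_contDiffOn hsymm)
  rw [graphPt_zero h0] at hg
  have hfl : Tendsto (flatten k) (𝓝 0) (𝓝 0) := by
    simpa using (flatten k).continuous.tendsto 0
  refine ⟨g ∘ flatten k, ⟨sg.comp (flatten k).contDiff, fun p => congrArg g (flatten_flatten k p)⟩,
    by simp [hg.self_of_nhds, hs0], ?_⟩
  filter_upwards [hfl.eventually hg, e.open_source.mem_nhds h0e,
    hfl.eventually (e.open_target.mem_nhds (he0 ▸ e.map_source h0e))] with p hgp hps hpt
  rw [Function.comp_apply, hgp, ← graphPt_eq_flatten_iff (k := k), ← he]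
  refine ⟨fun h => by rw [← h, e.left_inv hps], fun h => ?_⟩
  have hflat : flatten k (e.symm (flatten k p)) = flatten k p := by
    rw [← flatten_graphPt ρ, ← he, e.right_inv hpt, flatten_flatten]
  have hsymm : e.symm (flatten k p) = p := by
    rw [flatten_apply k (e.symm _), ← h] at hflat
    exact sub_left_injective (hflat.trans (flatten_apply k p))
  simpa only [hsymm] using e.right_inv hpt

end Graph

section CRSlope

variable {N : ℕ} {k : Fin N} {r : (Fin N → ℂ) → ℝ} {S : Set (Fin N → ℂ)} {p : Fin N → ℂ}

theorem IsGraphFun.exists_curve (hr : IsGraphFun k r) {v : Fin N → ℂ} (hp : (p k).im = r p)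
    (hv : (v k).im = fderiv ℝ r p v) :
    ∃ γ : ℝ → Fin N → ℂ, γ 0 = p ∧ HasDerivAt γ v 0 ∧ ∀ t, (γ t k).im = r (γ t) := by
  have hline : HasDerivAt (fun t : ℝ => p + t • v) v 0 := by
    simpa using ((hasDerivAt_id (0 : ℝ)).smul_const v).const_add p
  have hpr : HasFDerivAt (graphPt k r) (flatten k + (fderiv ℝ r p).smulRight (imDir k))
      (p + (0 : ℝ) • v) := by
    rw [zero_smul, add_zero]
    exact hasFDerivAt_graphPt (differentiableAt_of_smooth hr.smooth p)
  have hvel : (flatten k + (fderiv ℝ r p).smulRight (imDir k)) v = v := by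
    change flatten k v + fderiv ℝ r p v • imDir k = v
    rw [← hv, flatten_apply, sub_add_cancel]
  have hγ := hpr.comp_hasDerivAt (0 : ℝ) hline
  rw [hvel] at hγ
  exact ⟨fun t => graphPt k r (p + t • v), by simp [graphPt_eq_self hp], hγ,
    fun t => hr.graphPt_mem _⟩

theorem IsGraphFun.mem_realTangent_iff (hr : IsGraphFun k r)
    (hS : ∀ᶠ q in 𝓝 p, (q ∈ S ↔ (q k).im = r q)) (hp : p ∈ S) (v : Fin N → ℂ) :
    v ∈ realTangent S p ↔ (v k).im = fderiv ℝ r p v := by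
  constructor
  · rintro ⟨γ, rfl, hγ, hmem⟩
    have him : HasDerivAt (fun t => imCoord k (γ t)) (v k).im 0 :=
      (imCoord k).hasFDerivAt.comp_hasDerivAt (0 : ℝ) hγ
    have hrγ : HasDerivAt (fun t => r (γ t)) (fderiv ℝ r (γ 0) v) 0 :=
      (differentiableAt_of_smooth hr.smooth (γ 0)).hasFDerivAt.comp_hasDerivAt (0 : ℝ) hγ
    refine him.unique (hrγ.congr_of_eventuallyEq ?_)
    filter_upwards [hγ.continuousAt.eventually hS, hmem] with t hSt ht using hSt.1 ht
  · intro hv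
    obtain ⟨γ, h0, hγ, hgraph⟩ := hr.exists_curve (hS.self_of_nhds.1 hp) hv
    have hcont : Tendsto γ (𝓝 0) (𝓝 p) := h0 ▸ hγ.continuousAt
    exact ⟨γ, h0, hγ, (hcont.eventually hS).mono fun t ht => ht.2 (hgraph t)⟩

/-- The complex linear form `2 ∂ρ`, for the defining function `ρ p = r p - Im p_k` of a graph. -/
noncomputable def delForm (k : Fin N) (r : (Fin N → ℂ) → ℝ) (p : Fin N → ℂ) :
    (Fin N → ℂ) →L[ℂ] ℂ :=
  StrongDual.extendRCLike (fderiv ℝ r p - imCoord k)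

theorem delForm_apply (u : Fin N → ℂ) :
    delForm k r p u =
      fderiv ℝ r p u - Complex.I * fderiv ℝ r p (Complex.I • u) + Complex.I * u k := by
  rw [delForm, StrongDual.extendRCLike_apply]
  apply Complex.ext <;> simp [imCoord_apply] <;> ring

theorem I_smul_reDir : Complex.I • reDir k = imDir k := by
  rw [← Pi.single_smul, smul_eq_mul, mul_one]

theorem smul_reDir (c : ℂ) : c • reDir k = c.re • reDir k + c.im • imDir k := by
  simp only [← Pi.single_smul, ← Pi.single_add]
  simp

theorem IsGraphFun.delForm_reDir (hr : IsGraphFun k r) :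
    delForm k r p (reDir k) = fderiv ℝ r p (reDir k) + Complex.I := by
  rw [delForm_apply, I_smul_reDir, fderiv_imDir_of_flat hr.flat]
  simp

theorem IsGraphFun.delForm_reDir_ne_zero (hr : IsGraphFun k r) :
    delForm k r p (reDir k) ≠ 0 := by
  rw [hr.delForm_reDir]
  intro h
  simpa using congrArg Complex.im h

/-- The complex linear form whose value at `u` is the slope of the graph of `r` over `u`: the
coefficient `a` such that `u + a e_k` is complex tangent to the graph. -/
noncomputable def slopeForm (k : Fin N) (r : (Fin N → ℂ) → ℝ) (p : Fin N → ℂ) :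
    (Fin N → ℂ) →L[ℂ] ℂ :=
  -(delForm k r p (reDir k))⁻¹ • delForm k r p

/-- The slope of the graph of `r` over the direction `u`, as a function of the point. -/
noncomputable def crSlope (k : Fin N) (r : (Fin N → ℂ) → ℝ) (u : Fin N → ℂ) : (Fin N → ℂ) → ℂ :=
  fun p => slopeForm k r p u

theorem crSlope_add (u v : Fin N → ℂ) : crSlope k r (u + v) = crSlope k r u + crSlope k r v :=
  funext fun p => (slopeForm k r p).map_add u v

theorem crSlope_sub (u v : Fin N → ℂ) : crSlope k r (u - v) = crSlope k r u - crSlope k r v :=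
  funext fun p => (slopeForm k r p).map_sub u v

theorem crSlope_smul (c : ℂ) (u : Fin N → ℂ) :
    crSlope k r (c • u) = (fun _ => c) * crSlope k r u :=
  funext fun p => (slopeForm k r p).map_smul c u

theorem IsGraphFun.mem_complexTangent_iff (hr : IsGraphFun k r)
    (hS : ∀ᶠ q in 𝓝 p, (q ∈ S ↔ (q k).im = r q)) (hp : p ∈ S) (v : Fin N → ℂ) :
    v ∈ complexTangent S p ↔ crSlope k r v p = 0 := by
  have himage : v ∈ (fun w : Fin N → ℂ => Complex.I • w) '' realTangent S p ↔
      -(Complex.I • v) ∈ realTangent S p := by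
    constructor
    · rintro ⟨w, hw, rfl⟩
      simpa only [smul_smul, Complex.I_mul_I, neg_smul, one_smul, neg_neg] using hw
    · exact fun h => ⟨_, h, by
        simp only [smul_neg, smul_smul, Complex.I_mul_I, neg_smul, one_smul, neg_neg]⟩
  have hre : (delForm k r p v).re = fderiv ℝ r p v - (v k).im := by
    simp [delForm_apply, sub_eq_add_neg]
  have him : (delForm k r p v).im = (v k).re - fderiv ℝ r p (Complex.I • v) := by
    simp [delForm_apply]
    ring
  have hslope : crSlope k r v p = 0 ↔ delForm k r p v = 0 := by
    simp [crSlope, slopeForm, hr.delForm_reDir_ne_zero]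
  rw [hslope, complexTangent, Set.mem_inter_iff, himage, hr.mem_realTangent_iff hS hp,
    hr.mem_realTangent_iff hS hp, Complex.ext_iff, hre, him, Complex.zero_re, Complex.zero_im,
    sub_eq_zero, sub_eq_zero, map_neg, Pi.neg_apply, Complex.neg_im, neg_inj, Pi.smul_apply,
    smul_eq_mul, Complex.I_mul_im, and_comm, eq_comm]

theorem IsGraphFun.crSlope_mul_delForm (hr : IsGraphFun k r) (u p : Fin N → ℂ) :
    crSlope k r u p * delForm k r p (reDir k) = -delForm k r p u := by
  rw [crSlope, slopeForm, smul_apply, smul_eq_mul, neg_mul, neg_mul, mul_right_comm,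
    inv_mul_cancel₀ hr.delForm_reDir_ne_zero, one_mul]

theorem IsGraphFun.crSlope_reDir (hr : IsGraphFun k r) (p : Fin N → ℂ) :
    crSlope k r (reDir k) p = -1 := by
  simp [crSlope, slopeForm, hr.delForm_reDir_ne_zero]

theorem contDiff_eval {L : (Fin N → ℂ) → (Fin N → ℂ) →L[ℂ] ℂ} (hL : ContDiff ℝ ∞ L)
    (u : Fin N → ℂ) : ContDiff ℝ ∞ fun p => L p u :=
  ((ContinuousLinearMap.apply ℂ ℂ u).restrictScalars ℝ).contDiff.comp hL

theorem IsGraphFun.contDiff_slopeForm (hr : IsGraphFun k r) : ContDiff ℝ ∞ (slopeForm k r) := by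
  have hdel : ContDiff ℝ ∞ (delForm k r) :=
    (StrongDual.extendRCLikeₗᵢ (𝕜 := ℂ) (F := Fin N → ℂ)).contDiff.comp
      ((hr.smooth.fderiv_right (m := ∞) (by simp)).sub contDiff_const)
  exact ((contDiff_eval hdel _).inv fun _ => hr.delForm_reDir_ne_zero).neg.smul hdel

theorem IsGraphFun.contDiff_crSlope (hr : IsGraphFun k r) (u : Fin N → ℂ) :
    ContDiff ℝ ∞ (crSlope k r u) :=
  contDiff_eval hr.contDiff_slopeForm u

theorem IsGraphFun.crSlope_flat (hr : IsGraphFun k r) (u p : Fin N → ℂ) :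
    crSlope k r u (flatten k p) = crSlope k r u p := by
  simp only [crSlope, slopeForm, delForm,
    fderiv_eq_of_flat hr.flat (flatten_flatten k p)]

end CRSlope

section LeviFlatGraph

variable {N : ℕ} {k : Fin N} {r : (Fin N → ℂ) → ℝ} {S : Set (Fin N → ℂ)} {p : Fin N → ℂ}

/-- The vector field with constant base direction `u` which is complex tangent to the graphs
`Im p_k = r p + c`. -/
noncomputable def tangentField (k : Fin N) (r : (Fin N → ℂ) → ℝ) (u p : Fin N → ℂ) : Fin N → ℂ :=
  u + crSlope k r u p • reDir k

/-- The Levi curvature of the graph of `r`: the coefficient of `reDir k` in the Lie bracket of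
`tangentField k r u` and `tangentField k r v`. -/
noncomputable def crCurvature (k : Fin N) (r : (Fin N → ℂ) → ℝ) (u v p : Fin N → ℂ) : ℂ :=
  fderiv ℝ (crSlope k r v) p (tangentField k r u p) -
    fderiv ℝ (crSlope k r u) p (tangentField k r v p)

theorem crSlope_congr {r' : (Fin N → ℂ) → ℝ} (h : r =ᶠ[𝓝 p] r') (u : Fin N → ℂ) :
    crSlope k r u =ᶠ[𝓝 p] crSlope k r' u :=
  (h.fderiv (𝕜 := ℝ)).mono fun q hq => by simp only [crSlope, slopeForm, delForm, hq]

theorem crCurvature_congr {r' : (Fin N → ℂ) → ℝ} (h : r =ᶠ[𝓝 p] r') (u v : Fin N → ℂ) :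
    crCurvature k r u v p = crCurvature k r' u v p := by
  have hslope (w : Fin N → ℂ) := crSlope_congr (k := k) h w
  simp only [crCurvature, tangentField, (hslope _).fderiv_eq, (hslope _).self_of_nhds]

theorem tangentField_eq_self {u : Fin N → ℂ} (h : crSlope k r u p = 0) :
    tangentField k r u p = u := by
  rw [tangentField, h, zero_smul, add_zero]

namespace IsGraphFun

theorem contDiff_tangentField (hr : IsGraphFun k r) (u : Fin N → ℂ) :
    ContDiff ℝ ∞ (tangentField k r u) :=
  contDiff_const.add ((hr.contDiff_crSlope u).smul contDiff_const)

theorem contDiff_crCurvature (hr : IsGraphFun k r) (u v : Fin N → ℂ) :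
    ContDiff ℝ ∞ (crCurvature k r u v) :=
  (((hr.contDiff_crSlope v).fderiv_right (by simp)).clm_apply (hr.contDiff_tangentField u)).sub
    (((hr.contDiff_crSlope u).fderiv_right (by simp)).clm_apply (hr.contDiff_tangentField v))

theorem crCurvature_eq_of_flatten_eq (hr : IsGraphFun k r) (u v : Fin N → ℂ) {q : Fin N → ℂ}
    (h : flatten k p = flatten k q) : crCurvature k r u v p = crCurvature k r u v q := by
  have hslope (w : Fin N → ℂ) : crSlope k r w p = crSlope k r w q := by
    rw [← hr.crSlope_flat w p, h, hr.crSlope_flat]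
  simp only [crCurvature, tangentField, hslope, fderiv_eq_of_flat (hr.crSlope_flat _) h]

theorem crSlope_tangentField (hr : IsGraphFun k r) (u p q : Fin N → ℂ) :
    crSlope k r (tangentField k r u p) q = crSlope k r u q - crSlope k r u p := by
  rw [tangentField, crSlope_add, crSlope_smul, Pi.add_apply, Pi.mul_apply, hr.crSlope_reDir,
    mul_neg_one, sub_eq_add_neg]

theorem crCurvature_tangentField (hr : IsGraphFun k r) (u v p : Fin N → ℂ) :
    crCurvature k r (tangentField k r u p) (tangentField k r v p) p = crCurvature k r u v p := by
  have hself (w : Fin N → ℂ) : tangentField k r (tangentField k r w p) p = tangentField k r w p :=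
    tangentField_eq_self (by rw [hr.crSlope_tangentField, sub_self])
  have hfderiv (w : Fin N → ℂ) :
      fderiv ℝ (crSlope k r (tangentField k r w p)) p = fderiv ℝ (crSlope k r w) p := by
    simp only [funext (hr.crSlope_tangentField w p), fderiv_sub_const]
  simp only [crCurvature, hself, hfderiv]

theorem crSlope_fderiv_eq (hr : IsGraphFun k r) (hp : (p k).im = r p)
    {X : (Fin N → ℂ) → Fin N → ℂ} (hX : DifferentiableAt ℝ X p)
    (htan : ∀ᶠ q in 𝓝 p, (q k).im = r q → crSlope k r (X q) q = 0)
    {w : Fin N → ℂ} (hw : (w k).im = fderiv ℝ r p w) :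
    crSlope k r (fderiv ℝ X p w) p = -fderiv ℝ (crSlope k r (X p)) p w := by
  obtain ⟨γ, rfl, hγ, hgraph⟩ := hr.exists_curve hp hw
  have hform := (differentiableAt_of_smooth hr.contDiff_slopeForm (γ 0)).hasFDerivAt
  have hslope : HasFDerivAt (crSlope k r (X (γ 0)))
      (((ContinuousLinearMap.apply ℂ ℂ (X (γ 0))).restrictScalars ℝ).comp
        (fderiv ℝ (slopeForm k r) (γ 0))) (γ 0) :=
    ((ContinuousLinearMap.apply ℂ ℂ (X (γ 0))).restrictScalars ℝ).hasFDerivAt.comp (γ 0) hform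
  have hprod := (((ContinuousLinearMap.restrictScalarsL ℂ (Fin N → ℂ) ℂ ℝ ℝ).hasFDerivAt.comp
    (γ 0) hform).clm_apply hX.hasFDerivAt).comp_hasDerivAt (0 : ℝ) hγ
  have hzero : HasDerivAt (fun t => crSlope k r (X (γ t)) (γ t)) 0 0 := by
    refine (hasDerivAt_const (0 : ℝ) (0 : ℂ)).congr_of_eventuallyEq ?_
    exact (hγ.continuousAt.eventually htan).mono fun t ht => ht (hgraph t)
  have hsum : crSlope k r (fderiv ℝ X (γ 0) w) (γ 0) +
      fderiv ℝ (slopeForm k r) (γ 0) w (X (γ 0)) = 0 := hprod.unique hzero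
  rw [hslope.fderiv]
  exact eq_neg_of_add_eq_zero_left hsum

theorem crSlope_lieBracket (hr : IsGraphFun k r) (hS : ∀ᶠ q in 𝓝 p, (q ∈ S ↔ (q k).im = r q))
    (hp : p ∈ S) {X Y : (Fin N → ℂ) → Fin N → ℂ} (hX : DifferentiableAt ℝ X p)
    (hY : DifferentiableAt ℝ Y p) (hXS : ∀ᶠ q in 𝓝 p, q ∈ S → X q ∈ complexTangent S q)
    (hYS : ∀ᶠ q in 𝓝 p, q ∈ S → Y q ∈ complexTangent S q) :
    crSlope k r (VectorField.lieBracket ℝ X Y p) p = -crCurvature k r (X p) (Y p) p := by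
  have hpr : (p k).im = r p := hS.self_of_nhds.1 hp
  have tangent {Z : (Fin N → ℂ) → Fin N → ℂ}
      (hZ : ∀ᶠ q in 𝓝 p, q ∈ S → Z q ∈ complexTangent S q) :
      ∀ᶠ q in 𝓝 p, (q k).im = r q → crSlope k r (Z q) q = 0 := by
    filter_upwards [hS.eventually_nhds, hZ] with q hq hZq hqr
    have hqS := hq.self_of_nhds.2 hqr
    exact (hr.mem_complexTangent_iff hq hqS _).1 (hZq hqS)
  have real {Z : (Fin N → ℂ) → Fin N → ℂ}
      (hZ : ∀ᶠ q in 𝓝 p, q ∈ S → Z q ∈ complexTangent S q) :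
      (Z p k).im = fderiv ℝ r p (Z p) :=
    (hr.mem_realTangent_iff hS hp _).1 (hZ.self_of_nhds hp).2
  rw [VectorField.lieBracket, crSlope_sub, Pi.sub_apply,
    hr.crSlope_fderiv_eq hpr hY (tangent hYS) (real hXS),
    hr.crSlope_fderiv_eq hpr hX (tangent hXS) (real hYS), crCurvature,
    tangentField_eq_self ((tangent hXS).self_of_nhds hpr),
    tangentField_eq_self ((tangent hYS).self_of_nhds hpr)]
  ring

theorem crCurvature_eq_zero (hr : IsGraphFun k r) (hflat : IsLeviFlat S)
    (hS : ∀ᶠ q in 𝓝 (graphPt k r p), (q ∈ S ↔ (q k).im = r q)) (u v : Fin N → ℂ) :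
    crCurvature k r u v p = 0 := by
  have hp : graphPt k r p ∈ S := hS.self_of_nhds.2 (hr.graphPt_mem p)
  obtain ⟨U, hU, hUo, hpU⟩ := eventually_nhds_iff.1 hS.eventually_nhds
  have tangent (w : Fin N → ℂ) : ∀ q ∈ S ∩ U, tangentField k r w q ∈ complexTangent S q :=
    fun q hq => (hr.mem_complexTangent_iff (hU q hq.2) hq.1 _).2
      (by rw [hr.crSlope_tangentField, sub_self])
  have near (w : Fin N → ℂ) :
      ∀ᶠ q in 𝓝 (graphPt k r p), q ∈ S → tangentField k r w q ∈ complexTangent S q :=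
    (hUo.eventually_mem hpU).mono fun q hqU hqS => tangent w q ⟨hqS, hqU⟩
  have smooth := hr.contDiff_tangentField
  have hbracket := hflat U _ _ hUo (smooth u).contDiffOn (smooth v).contDiffOn
    (tangent u) (tangent v) _ ⟨hp, hpU⟩
  rw [hr.mem_complexTangent_iff hS hp, hr.crSlope_lieBracket hS hp
    (differentiableAt_of_smooth (smooth u) _) (differentiableAt_of_smooth (smooth v) _)
    (near u) (near v), neg_eq_zero, hr.crCurvature_tangentField] at hbracket
  rw [← hbracket, hr.crCurvature_eq_of_flatten_eq u v (flatten_graphPt r p)]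

theorem isLeviFlat (hr : IsGraphFun k r)
    (hS : ∀ p ∈ S, ∀ᶠ q in 𝓝 p, (q ∈ S ↔ (q k).im = r q))
    (hcurv : ∀ p ∈ S, ∀ u v, crCurvature k r u v p = 0) : IsLeviFlat S := by
  intro U X Y hU hX hY hXS hYS p hp
  have hpU : U ∈ 𝓝 p := hU.mem_nhds hp.2
  have near {Z : (Fin N → ℂ) → Fin N → ℂ} (hZ : ∀ q ∈ S ∩ U, Z q ∈ complexTangent S q) :
      ∀ᶠ q in 𝓝 p, q ∈ S → Z q ∈ complexTangent S q :=
    (hU.eventually_mem hp.2).mono fun q hqU hqS => hZ q ⟨hqS, hqU⟩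
  rw [hr.mem_complexTangent_iff (hS p hp.1) hp.1, hr.crSlope_lieBracket (hS p hp.1) hp.1
    ((hX.contDiffAt hpU).differentiableAt (by simp))
    ((hY.contDiffAt hpU).differentiableAt (by simp)) (near hXS) (near hYS), hcurv p hp.1, neg_zero]

end IsGraphFun

/-- The frame `e, i e, e_k` for the Cauchy–Riemann operator of a graph over the `k`-th coordinate
along the complex direction `e`. -/
noncomputable def crFrame (k : Fin N) (e : Fin N → ℂ) : Fin 3 → Fin N → ℂ :=
  ![e, Complex.I • e, reDir k]

theorem IsGraphFun.crCurvature_smul_I (hr : IsGraphFun k r) (e p : Fin N → ℂ) :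
    crCurvature k r e (Complex.I • e) p =
      Complex.I * crOp (crFrame k e) (crSlope k r e) (crSlope k r e) p := by
  set b := crSlope k r e with hb
  have hderiv (u : Fin N → ℂ) (c : ℂ) :
      fderiv ℝ b p (u + c • reDir k) = fderiv ℝ b p u + c.re * fderiv ℝ b p (reDir k) := by
    rw [smul_reDir, map_add, map_add, map_smul, map_smul,
      fderiv_imDir_of_flat (hr.crSlope_flat e), smul_zero, add_zero, Complex.real_smul]
  have hbI : crSlope k r (Complex.I • e) = Complex.I • b := by rw [crSlope_smul]; rfl
  have hbIderiv : fderiv ℝ (Complex.I • b) p = Complex.I • fderiv ℝ b p :=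
    fderiv_const_smul (differentiableAt_of_smooth (hr.contDiff_crSlope e) p) _
  have hstar : star (b p) = (b p).re - (b p).im * Complex.I := by
    apply Complex.ext <;> simp
  simp only [crCurvature, tangentField, hbI, hbIderiv, ← hb, Pi.smul_apply, smul_apply, hderiv,
    crOp_eq, crFrame, dirDeriv, Pi.add_apply, Pi.mul_apply, Pi.star_apply, hstar, smul_eq_mul,
    Complex.I_mul_re, Matrix.cons_val]
  push_cast
  linear_combination
    ((b p).im * fderiv ℝ b p (reDir k) - fderiv ℝ b p (Complex.I • e)) * Complex.I_sq

theorem IsGraphFun.crOp_crSlope_eq_zero (hr : IsGraphFun k r) (e : Fin N → ℂ)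
    (h : ∀ u v, crCurvature k r u v p = 0) :
    crOp (crFrame k e) (crSlope k r e) (crSlope k r e) p = 0 :=
  (mul_eq_zero.1 ((hr.crCurvature_smul_I e p).symm.trans (h _ _))).resolve_left Complex.I_ne_zero

theorem IsGraphFun.crOp_ofReal (hr : IsGraphFun k r) {e : Fin N → ℂ} (he : e k = 0) :
    crOp (crFrame k e) (crSlope k r e) (fun p => (r p : ℂ)) =
      (fun _ => Complex.I) * star (crSlope k r e) := by
  ext p
  have hslope := hr.crSlope_mul_delForm e p
  rw [hr.delForm_reDir, delForm_apply, he, mul_zero, add_zero] at hslope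
  have hstar := congrArg star hslope
  simp only [star_mul', star_add, star_neg, star_sub, Complex.star_def,
    Complex.conj_I, Complex.conj_ofReal] at hstar
  simp only [crOp_eq, crFrame, dirDeriv_ofReal hr.smooth, dirDeriv, Pi.add_apply,
    Pi.mul_apply, Pi.star_apply, Matrix.cons_val, Complex.star_def]
  linear_combination hstar

end LeviFlatGraph

section Reflection

variable {N : ℕ} {j k : Fin N} {r : (Fin N → ℂ) → ℝ} {σ : ℝ}

/-- Complex conjugation of all coordinates of `ℂ^N`, as a real linear map. -/
noncomputable def conjMap (N : ℕ) : (Fin N → ℂ) →L[ℝ] (Fin N → ℂ) :=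
  (starL' ℝ : (Fin N → ℂ) ≃L[ℝ] (Fin N → ℂ))

theorem conjMap_eq_star (p : Fin N → ℂ) : conjMap N p = star p := rfl

theorem conjMap_apply_im (p : Fin N → ℂ) (i : Fin N) : (conjMap N p i).im = -(p i).im := rfl

theorem conjMap_smul (c : ℂ) (p : Fin N → ℂ) : conjMap N (c • p) = star c • conjMap N p :=
  star_smul c p

theorem conjMap_reDir : conjMap N (reDir k) = reDir k := by
  rw [conjMap_eq_star, Pi.star_single, star_one]

theorem conjMap_imDir : conjMap N (imDir k) = -imDir k := by
  rw [← I_smul_reDir, conjMap_smul, conjMap_reDir, Complex.star_def, Complex.conj_I, neg_smul]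

theorem conjMap_flatten (p : Fin N → ℂ) : conjMap N (flatten k p) = flatten k (conjMap N p) := by
  rw [flatten_apply, flatten_apply, map_sub, map_smul, conjMap_imDir, conjMap_apply_im, neg_smul,
    smul_neg]

/-- The function whose graph is conjugate to the graph of `r`. -/
noncomputable def reflectFun (r : (Fin N → ℂ) → ℝ) : (Fin N → ℂ) → ℝ :=
  fun p => -r (conjMap N p)

namespace IsGraphFun

theorem reflect (hr : IsGraphFun k r) : IsGraphFun k (reflectFun r) where
  smooth := (hr.smooth.comp (conjMap N).contDiff).neg
  flat p := by simp only [reflectFun, conjMap_flatten, hr.flat]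

theorem fderiv_reflectFun (hr : IsGraphFun k r) (p u : Fin N → ℂ) :
    fderiv ℝ (reflectFun r) p u = -fderiv ℝ r (conjMap N p) (conjMap N u) :=
  congrArg (· u) (((differentiableAt_of_smooth hr.smooth (conjMap N p)).hasFDerivAt.comp p
    (conjMap N).hasFDerivAt).neg).fderiv

theorem delForm_reflectFun (hr : IsGraphFun k r) (p u : Fin N → ℂ) :
    delForm k (reflectFun r) p u = -star (delForm k r (conjMap N p) (conjMap N u)) := by
  have hu : conjMap N u k = star (u k) := rfl
  simp only [delForm_apply, hr.fderiv_reflectFun, conjMap_smul, Complex.star_def, Complex.conj_I,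
    neg_smul, map_neg, map_add, map_sub, map_mul, Complex.conj_ofReal, hu, Complex.conj_conj]
  push_cast
  ring

theorem crSlope_reflectFun (hr : IsGraphFun k r) (u : Fin N → ℂ) :
    crSlope k (reflectFun r) u = star (crSlope k r (conjMap N u) ∘ conjMap N) := by
  ext p
  have hne := hr.reflect.delForm_reDir_ne_zero (p := p)
  have h := hr.crSlope_mul_delForm (conjMap N u) (conjMap N p)
  refine mul_right_cancel₀ hne ?_
  rw [hr.reflect.crSlope_mul_delForm, hr.delForm_reflectFun, hr.delForm_reflectFun, conjMap_reDir,
    mul_neg, neg_inj, Pi.star_apply, Function.comp_apply, ← star_mul', h, star_neg]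

theorem crCurvature_reflectFun (hr : IsGraphFun k r) (u v p : Fin N → ℂ) :
    crCurvature k (reflectFun r) u v p =
      star (crCurvature k r (conjMap N u) (conjMap N v) (conjMap N p)) := by
  have hfield (w : Fin N → ℂ) : conjMap N (tangentField k (reflectFun r) w p) =
      tangentField k r (conjMap N w) (conjMap N p) := by
    rw [tangentField, tangentField, map_add, conjMap_smul, conjMap_reDir, hr.crSlope_reflectFun,
      Pi.star_apply, star_star, Function.comp_apply]
  have hderiv (w z : Fin N → ℂ) : fderiv ℝ (crSlope k (reflectFun r) w) p z =
      star (fderiv ℝ (crSlope k r (conjMap N w)) (conjMap N p) (conjMap N z)) := by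
    have hslope := hr.contDiff_crSlope (conjMap N w)
    rw [hr.crSlope_reflectFun]
    change dirDeriv z (star (crSlope k r (conjMap N w) ∘ conjMap N)) p = _
    rw [dirDeriv_star (hslope.comp (conjMap N).contDiff), dirDeriv_comp_clm hslope]
    rfl
  simp only [crCurvature, hderiv, hfield, star_sub]

end IsGraphFun

/-- The function `p ↦ σ Im p_j`, with `σ = ±1`, whose zero set carries the edge of a hypersurface
with boundary, and which is nonnegative on the hypersurface. -/
noncomputable def sideCoord (σ : ℝ) (j : Fin N) : (Fin N → ℂ) →L[ℝ] ℝ := σ • imCoord j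

theorem sideCoord_apply (p : Fin N → ℂ) : sideCoord σ j p = σ * (p j).im := rfl

theorem sideCoord_conjMap (p : Fin N → ℂ) : sideCoord σ j (conjMap N p) = -sideCoord σ j p := by
  rw [sideCoord_apply, sideCoord_apply, conjMap_apply_im, mul_neg]

theorem sideCoord_reDir : sideCoord σ j (reDir k) = 0 := by
  by_cases h : j = k
  · subst h
    simp [sideCoord_apply]
  · simp [sideCoord_apply, h]

theorem sideCoord_smul_reDir : sideCoord σ j (σ • reDir j) = 0 := by
  rw [map_smul, sideCoord_reDir, smul_zero]

theorem sideCoord_I_smul (hσ : σ * σ = 1) : sideCoord σ j (Complex.I • σ • reDir j) = 1 := by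
  simp [sideCoord_apply, hσ]

theorem smul_reDir_apply_of_ne (hjk : j ≠ k) : (σ • reDir j) k = 0 := by
  simp [hjk.symm]

theorem eq_of_fderiv_eq_zero_on_segment {E G : Type*} [NormedAddCommGroup E] [NormedSpace ℝ E]
    [NormedAddCommGroup G] [NormedSpace ℝ G] {f : E → G} (hf : Differentiable ℝ f) {p q : E}
    (h : ∀ x ∈ segment ℝ p q, fderiv ℝ f x (q - p) = 0) : f q = f p := by
  have hline (t : ℝ) : HasDerivAt (fun t : ℝ => p + t • (q - p)) (q - p) t := by
    simpa using ((hasDerivAt_id t).smul_const (q - p)).const_add p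
  have hderiv : ∀ t ∈ Set.Icc (0 : ℝ) 1,
      HasDerivAt (fun t : ℝ => f (p + t • (q - p))) 0 t := fun t ht => by
    have hx : p + t • (q - p) ∈ segment ℝ p q := by
      rw [segment_eq_image']
      exact ⟨t, ht, rfl⟩
    rw [← h _ hx]
    exact (hf _).hasFDerivAt.comp_hasDerivAt t (hline t)
  have hconst := constant_of_has_deriv_right_zero
    (fun t ht => (hderiv t ht).continuousAt.continuousWithinAt)
    (fun t ht => (hderiv t (Set.Ico_subset_Icc_self ht)).hasDerivWithinAt) 1 (by simp)
  simpa using hconst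

section Edge

variable {C : Set (Fin N → ℂ)} {u p : Fin N → ℂ}

namespace IsGraphFun

theorem fderiv_eq_zero_on_edge (hr : IsGraphFun k r) (hC : IsOpen C)
    (h0 : ∀ p ∈ C ∩ {p | sideCoord σ j p = 0}, r p = 0) (hu : sideCoord σ j u = 0)
    (hp : p ∈ C ∩ {p | sideCoord σ j p = 0}) : fderiv ℝ r p u = 0 :=
  dirDeriv_eq_zero_of_tangent hC hr.smooth h0 hu p hp

theorem crSlope_eq_zero_on_edge (hr : IsGraphFun k r) (hC : IsOpen C)
    (h0 : ∀ p ∈ C ∩ {p | sideCoord σ j p = 0}, r p = 0) (hj : u j = 0) (hk : u k = 0)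
    (hp : p ∈ C ∩ {p | sideCoord σ j p = 0}) : crSlope k r u p = 0 := by
  have hderiv (v : Fin N → ℂ) (hv : v j = 0) : fderiv ℝ r p v = 0 :=
    hr.fderiv_eq_zero_on_edge hC h0 (by simp [sideCoord_apply, hv]) hp
  have h := hr.crSlope_mul_delForm u p
  rw [delForm_apply (u := u), hderiv u hj, hderiv (Complex.I • u) (by simp [hj]), hk] at h
  simpa [hr.delForm_reDir_ne_zero] using h

theorem star_crSlope_on_edge (hr : IsGraphFun k r) (hjk : j ≠ k) (hC : IsOpen C)
    (h0 : ∀ p ∈ C ∩ {p | sideCoord σ j p = 0}, r p = 0)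
    (hp : p ∈ C ∩ {p | sideCoord σ j p = 0}) :
    star (crSlope k r (σ • reDir j) p) = crSlope k r (σ • reDir j) p := by
  have h := hr.crSlope_mul_delForm (σ • reDir j) p
  rw [hr.delForm_reDir, delForm_apply, hr.fderiv_eq_zero_on_edge hC h0 sideCoord_reDir hp,
    hr.fderiv_eq_zero_on_edge hC h0 sideCoord_smul_reDir hp, smul_reDir_apply_of_ne hjk,
    Complex.ofReal_zero] at h
  have hreal : crSlope k r (σ • reDir j) p = fderiv ℝ r p (Complex.I • σ • reDir j) := by
    refine mul_right_cancel₀ Complex.I_ne_zero ?_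
    linear_combination h
  rw [hreal, Complex.star_def, Complex.conj_ofReal]

theorem fderiv_crSlope_on_edge (hr : IsGraphFun k r) (hjk : j ≠ k) (hσ : σ * σ = 1)
    (hC : IsOpen C) (h0 : ∀ p ∈ C ∩ {p | sideCoord σ j p = 0}, r p = 0)
    (hcurv : ∀ p ∈ C, 0 < sideCoord σ j p → ∀ u v, crCurvature k r u v p = 0)
    (hj : u j = 0) (hk : u k = 0) (hp : p ∈ C ∩ {p | sideCoord σ j p = 0}) :
    fderiv ℝ (crSlope k r (σ • reDir j)) p u = 0 := by
  have hcurv0 : crCurvature k r (σ • reDir j) u p = 0 :=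
    eq_zero_on_hyperplane_of_side hC (by rw [sideCoord_I_smul hσ]; exact one_pos)
      (hr.contDiff_crCurvature _ u).continuous (fun q hq hy => hcurv q hq hy _ u) p hp
  have htangent : sideCoord σ j (tangentField k r (σ • reDir j) p) = 0 := by
    rw [tangentField, smul_reDir, Complex.conj_eq_iff_im.1 (hr.star_crSlope_on_edge hjk hC h0 hp),
      zero_smul, add_zero]
    simp only [map_add, map_smul, sideCoord_reDir, smul_zero, add_zero]
  have hslope : fderiv ℝ (crSlope k r u) p (tangentField k r (σ • reDir j) p) = 0 :=
    dirDeriv_eq_zero_of_tangent hC (hr.contDiff_crSlope u)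
      (fun q hq => hr.crSlope_eq_zero_on_edge hC h0 hj hk hq) htangent p hp
  rwa [crCurvature, hslope, zero_sub, neg_eq_zero,
    tangentField_eq_self (hr.crSlope_eq_zero_on_edge hC h0 hj hk hp)] at hcurv0

theorem crSlope_reflectFun_on_edge (hr : IsGraphFun k r) (hjk : j ≠ k) (hσ : σ * σ = 1)
    (hC : IsOpen C) (hconv : Convex ℝ C) (hconj : ∀ p ∈ C, conjMap N p ∈ C)
    (h0 : ∀ p ∈ C ∩ {p | sideCoord σ j p = 0}, r p = 0)
    (hcurv : ∀ p ∈ C, 0 < sideCoord σ j p → ∀ u v, crCurvature k r u v p = 0)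
    (hp : p ∈ C ∩ {p | sideCoord σ j p = 0}) :
    crSlope k (reflectFun r) (σ • reDir j) p = crSlope k r (σ • reDir j) p := by
  have hpc : conjMap N p ∈ C ∩ {p | sideCoord σ j p = 0} :=
    ⟨hconj p hp.1, (sideCoord_conjMap p).trans (neg_eq_zero.2 hp.2)⟩
  rw [hr.crSlope_reflectFun, Pi.star_apply, Function.comp_apply, map_smul, conjMap_reDir,
    hr.star_crSlope_on_edge hjk hC h0 hpc]
  refine eq_of_fderiv_eq_zero_on_segment
    ((hr.contDiff_crSlope _).differentiable (by simp)) fun x hx => ?_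
  have hxZ : x ∈ C ∩ {p | sideCoord σ j p = 0} :=
    (hconv.inter (convex_hyperplane (sideCoord σ j).isLinear 0)).segment_subset hp hpc hx
  set w := conjMap N p - p with hw
  have hre (i : Fin N) : (w i).re = 0 := by simp [hw, conjMap_eq_star]
  have hwj : w j = 0 := by
    have hpj : (p j).im = 0 := (mul_eq_zero.1 hp.2).resolve_left (left_ne_zero_of_mul_eq_one hσ)
    refine Complex.ext (hre j) ?_
    simp [hw, conjMap_eq_star, hpj]
  have hwk : flatten k w k = 0 := by
    refine Complex.ext ?_ (flatten_apply_self_im k w)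
    simp [flatten_apply, hre]
  have hsplit : w = flatten k w + (w k).im • imDir k := (sub_add_cancel _ _).symm
  rw [hsplit, map_add, map_smul, fderiv_imDir_of_flat (hr.crSlope_flat _), smul_zero, add_zero]
  exact hr.fderiv_crSlope_on_edge hjk hσ hC h0 hcurv
    ((flatten_apply_of_ne k w hjk).trans hwj) hwk hxZ

theorem vanishTo_sub_reflectFun (hr : IsGraphFun k r) (hjk : j ≠ k) (hσ : σ * σ = 1)
    (hC : IsOpen C) (hconv : Convex ℝ C) (hconj : ∀ p ∈ C, conjMap N p ∈ C)
    (h0 : ∀ p ∈ C ∩ {p | sideCoord σ j p = 0}, r p = 0)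
    (hcurv : ∀ p ∈ C, 0 < sideCoord σ j p → ∀ u v, crCurvature k r u v p = 0) (n : ℕ) :
    VanishTo (C ∩ {p | sideCoord σ j p = 0}) n
      ((fun p => (r p : ℂ)) - fun p => (reflectFun r p : ℂ)) := by
  set e : Fin N → ℂ := σ • reDir j with he
  have hek : e k = 0 := smul_reDir_apply_of_ne hjk
  have hcurv' : ∀ p ∈ C, 0 < (-sideCoord σ j) p → ∀ u v, crCurvature k (reflectFun r) u v p = 0 :=
    fun p hp hy u v => by
      rw [hr.crCurvature_reflectFun, hcurv _ (hconj p hp) (by rwa [sideCoord_conjMap]), star_zero]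
  have hslope := hr.contDiff_crSlope e
  have hslope' := hr.reflect.contDiff_crSlope e
  have hZ : C ∩ {p | (-sideCoord σ j) p = 0} = C ∩ {p | sideCoord σ j p = 0} := by
    simp
  refine vanishTo_sub_of_crOp hC sideCoord_smul_reDir (sideCoord_I_smul hσ) sideCoord_reDir hslope
    hslope' (contDiff_ofReal hr.smooth) (contDiff_ofReal hr.reflect.smooth)
    (vanishTo_of_side hC (Y := Complex.I • e) (by simp [he, sideCoord_I_smul hσ])
      (contDiff_crOp hslope hslope) fun p hp hy => hr.crOp_crSlope_eq_zero e (hcurv p hp hy))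
    (hZ ▸ vanishTo_of_side hC (Y := -(Complex.I • e)) (by simp [he, sideCoord_I_smul hσ])
      (contDiff_crOp hslope' hslope') fun p hp hy =>
        hr.reflect.crOp_crSlope_eq_zero e (hcurv' p hp hy))
    (hr.crOp_ofReal hek) (hr.reflect.crOp_ofReal hek)
    (fun p hp => (hr.crSlope_reflectFun_on_edge hjk hσ hC hconv hconj h0 hcurv hp).symm)
    (fun p hp => ?_) n
  simp [reflectFun, h0 p hp, h0 _ ⟨hconj p hp.1, (sideCoord_conjMap p).trans (neg_eq_zero.2 hp.2)⟩]

end IsGraphFun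

end Edge

end Reflection

section Extension

theorem eventually_eventuallyEq_of_pos {X T : Type*} [TopologicalSpace X] {y : X → ℝ} {x : X}
    (hy : Continuous y) {f g : X → T} (h : ∀ᶠ p in 𝓝 x, 0 < y p → f p = g p) :
    ∀ᶠ p in 𝓝 x, 0 < y p → f =ᶠ[𝓝 p] g := by
  filter_upwards [h.eventually_nhds] with p hp hpos
  filter_upwards [hp, hy.continuousAt.eventually (lt_mem_nhds hpos)] with q hq hqpos
  exact hq hqpos

theorem eventually_eq_zero_of_pos {E T : Type*} [NormedAddCommGroup E] [NormedSpace ℝ E]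
    [TopologicalSpace T] [T2Space T] [Zero T] {y : E →L[ℝ] ℝ} {Y x : E} (hY : 0 < y Y) {f : E → T}
    (hf : Continuous f) (h : ∀ᶠ p in 𝓝 x, 0 < y p → f p = 0) :
    ∀ᶠ p in 𝓝 x, 0 ≤ y p → f p = 0 := by
  obtain ⟨C, hC, hCo, hxC⟩ := eventually_nhds_iff.1 h
  filter_upwards [hCo.mem_nhds hxC] with p hpC hp
  rcases hp.eq_or_lt with hp | hp
  · exact eq_zero_on_hyperplane_of_side hCo hY hf hC p ⟨hpC, hp.symm⟩
  · exact hC p hpC hp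

variable {N : ℕ} {j k : Fin N} {r : (Fin N → ℂ) → ℝ} {σ : ℝ}

theorem sideCoord_flatten (hjk : j ≠ k) (p : Fin N → ℂ) :
    sideCoord σ j (flatten k p) = sideCoord σ j p := by
  rw [sideCoord_apply, sideCoord_apply, flatten_apply_of_ne k p hjk]

theorem sideCoord_graphPt (hjk : j ≠ k) (p : Fin N → ℂ) :
    sideCoord σ j (graphPt k r p) = sideCoord σ j p := by
  rw [sideCoord_apply, sideCoord_apply, graphPt_apply_of_ne r p hjk]

/-- The function equal to `r` on the side `σ Im p_j ≥ 0` and to `reflectFun r` on the other. -/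
noncomputable def reflectExtend (σ : ℝ) (j : Fin N) (r : (Fin N → ℂ) → ℝ) : (Fin N → ℂ) → ℝ :=
  reflectFun r + cutSide (sideCoord σ j) (r - reflectFun r)

theorem reflectExtend_of_nonneg {p : Fin N → ℂ} (hp : 0 ≤ sideCoord σ j p) :
    reflectExtend σ j r p = r p := by
  simp [reflectExtend, cutSide_of_nonneg hp]

theorem reflectExtend_of_neg {p : Fin N → ℂ} (hp : sideCoord σ j p < 0) :
    reflectExtend σ j r p = reflectFun r p := by
  simp [reflectExtend, cutSide_of_neg hp]

namespace IsGraphFun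

theorem eventually_crCurvature_eq_zero (hr : IsGraphFun k r) (hr0 : r 0 = 0)
    {S D : Set (Fin N → ℂ)} (hflat : IsLeviFlat S) (hD : IsOpen D)
    (hS : ∀ᶠ p in 𝓝 0, p ∈ D → (p ∈ S ↔ (p k).im = r p)) :
    ∀ᶠ p in 𝓝 0, graphPt k r p ∈ D → ∀ u v, crCurvature k r u v p = 0 := by
  filter_upwards [(hr.tendsto_graphPt hr0).eventually hS.eventually_nhds] with p hp hpD
  refine hr.crCurvature_eq_zero hflat ?_
  filter_upwards [hp, hD.mem_nhds hpD] with q hq hqD using hq hqD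

theorem contDiffOn_reflectExtend (hr : IsGraphFun k r) {C : Set (Fin N → ℂ)} (hC : IsOpen C)
    (h : ∀ n, VanishTo (C ∩ {p | sideCoord σ j p = 0}) n
      ((fun p => (r p : ℂ)) - fun p => (reflectFun r p : ℂ))) :
    ContDiffOn ℝ ∞ (reflectExtend σ j r) C :=
  hr.reflect.smooth.contDiffOn.add <|
    contDiffOn_cutSide hC (hr.smooth.sub hr.reflect.smooth) fun n =>
      (h n).clm_comp ((contDiff_ofReal hr.smooth).sub (contDiff_ofReal hr.reflect.smooth))
        Complex.reCLM

theorem exists_reflection_extension (hr : IsGraphFun k r) (hjk : j ≠ k) (hσ : σ * σ = 1)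
    (hedge : ∀ᶠ p in 𝓝 0, sideCoord σ j p = 0 → r p = 0)
    (hcurv : ∀ᶠ p in 𝓝 0, 0 < sideCoord σ j p → ∀ u v, crCurvature k r u v p = 0) :
    ∃ R, IsGraphFun k R ∧ (∀ᶠ p in 𝓝 0, 0 ≤ sideCoord σ j p → R p = r p) ∧
      ∀ᶠ p in 𝓝 0, sideCoord σ j p < 0 → R p = reflectFun r p := by
  obtain ⟨ε, hε, hball⟩ := Metric.eventually_nhds_iff_ball.1 (hedge.and hcurv)
  have hconj : ∀ p ∈ Metric.ball (0 : Fin N → ℂ) ε, conjMap N p ∈ Metric.ball 0 ε := by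
    simp [conjMap_eq_star]
  have hsmooth := hr.contDiffOn_reflectExtend Metric.isOpen_ball fun n =>
    hr.vanishTo_sub_reflectFun hjk hσ Metric.isOpen_ball (convex_ball 0 ε) hconj
      (fun p hp => (hball p hp.1).1 hp.2) (fun p hp => (hball p hp).2) n
  obtain ⟨g, sg, hg⟩ := exists_contDiff_eventuallyEq (Metric.ball_mem_nhds 0 hε) hsmooth
  have hR : ∀ᶠ p in 𝓝 0, g (flatten k p) = reflectExtend σ j r (flatten k p) :=
    ((flatten k).continuous.tendsto' 0 0 (map_zero _)).eventually hg
  refine ⟨g ∘ flatten k, ⟨sg.comp (flatten k).contDiff, fun p => congrArg g (flatten_flatten k p)⟩,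
    hR.mono fun p hp hy => ?_, hR.mono fun p hp hy => ?_⟩ <;> rw [← sideCoord_flatten hjk] at hy
  · rw [Function.comp_apply, hp, reflectExtend_of_nonneg hy, hr.flat]
  · rw [Function.comp_apply, hp, reflectExtend_of_neg hy, hr.reflect.flat]

theorem eventually_crCurvature_eq_zero_of_sides (hr : IsGraphFun k r) (hσ : σ * σ = 1)
    (hpos : ∀ᶠ p in 𝓝 0, 0 < sideCoord σ j p → ∀ u v, crCurvature k r u v p = 0)
    (hneg : ∀ᶠ p in 𝓝 0, sideCoord σ j p < 0 → ∀ u v, crCurvature k r u v p = 0) :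
    ∀ᶠ p in 𝓝 0, ∀ u v, crCurvature k r u v p = 0 := by
  have hcont : Continuous fun p u v => crCurvature k r u v p :=
    continuous_pi fun u => continuous_pi fun v => (hr.contDiff_crCurvature u v).continuous
  have hnonneg := eventually_eq_zero_of_pos (sideCoord_I_smul hσ ▸ one_pos) hcont
    (hpos.mono fun p hp hy => funext₂ (hp hy))
  filter_upwards [hneg, hnonneg] with p hp hp'
  rcases lt_or_ge (sideCoord σ j p) 0 with hy | hy
  · exact hp hy
  · exact fun u v => congrFun₂ (hp' hy) u v

theorem exists_leviFlat_extension (hr : IsGraphFun k r) (hjk : j ≠ k) (hσ : σ * σ = 1)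
    (hedge : ∀ᶠ p in 𝓝 0, sideCoord σ j p = 0 → r p = 0)
    (hcurv : ∀ᶠ p in 𝓝 0, 0 < sideCoord σ j p → ∀ u v, crCurvature k r u v p = 0) :
    ∃ R, IsGraphFun k R ∧ (∀ᶠ p in 𝓝 0, 0 ≤ sideCoord σ j p → R p = r p) ∧
      ∀ᶠ p in 𝓝 0, ∀ u v, crCurvature k R u v p = 0 := by
  obtain ⟨R, hR, hpos, hneg⟩ := hr.exists_reflection_extension hjk hσ hedge hcurv
  refine ⟨R, hR, hpos, hR.eventually_crCurvature_eq_zero_of_sides (j := j) hσ ?_ ?_⟩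
  · filter_upwards [hcurv, eventually_eventuallyEq_of_pos (sideCoord σ j).continuous
      (hpos.mono fun p hp hy => hp hy.le)] with p hp heq hy u v
    rw [crCurvature_congr (heq hy), hp hy]
  · have hconj : Tendsto (conjMap N) (𝓝 0) (𝓝 0) :=
      (conjMap N).continuous.tendsto' 0 0 (map_zero _)
    filter_upwards [hconj.eventually hcurv,
      eventually_eventuallyEq_of_pos (-sideCoord σ j).continuous
        (hneg.mono fun p hp hy => hp (neg_pos.1 hy))] with p hp heq hy u v
    rw [crCurvature_congr (heq (neg_pos.2 hy)), hr.crCurvature_reflectFun,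
      hp (by rw [sideCoord_conjMap]; exact neg_pos.2 hy), star_zero]

theorem eventually_eq_of_crCurvature {r' : (Fin N → ℂ) → ℝ} (hr : IsGraphFun k r)
    (hr' : IsGraphFun k r') (hjk : j ≠ k) (hσ : σ * σ = 1)
    (hcurv : ∀ᶠ p in 𝓝 0, ∀ u v, crCurvature k r u v p = 0)
    (hcurv' : ∀ᶠ p in 𝓝 0, ∀ u v, crCurvature k r' u v p = 0)
    (hside : ∀ᶠ p in 𝓝 0, 0 ≤ sideCoord σ j p → r p = r' p) : ∀ᶠ p in 𝓝 0, r p = r' p := by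
  set e : Fin N → ℂ := σ • reDir j
  have hek : e k = 0 := smul_reDir_apply_of_ne hjk
  have hslope : ∀ᶠ p in 𝓝 0, 0 ≤ sideCoord σ j p → crSlope k r e p = crSlope k r' e p := by
    have hdiff := eventually_eq_zero_of_pos (x := 0) (sideCoord_I_smul hσ ▸ one_pos)
      ((hr.contDiff_crSlope e).sub (hr'.contDiff_crSlope e)).continuous
      ((eventually_eventuallyEq_of_pos (sideCoord σ j).continuous
        (hside.mono fun p hp hy => hp hy.le)).mono
        fun p hp hy => sub_eq_zero.2 (crSlope_congr (hp hy) e).self_of_nhds)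
    exact hdiff.mono fun p hp hy => sub_eq_zero.1 (hp hy)
  have hnonchar : crOp (crFrame k e) (crSlope k r e) (fun p => (sideCoord σ j p : ℂ)) 0 ≠ 0 := by
    simp [crOp_eq, crFrame, dirDeriv_ofReal (sideCoord σ j).contDiff, dirDeriv, e,
      sideCoord_I_smul hσ, sideCoord_reDir]
  have heq := eventually_eq_of_crOp (hr.contDiff_crSlope e) (hr'.contDiff_crSlope e)
    (contDiff_ofReal hr.smooth) (contDiff_ofReal hr'.smooth)
    (hcurv.mono fun p hp => hr.crOp_crSlope_eq_zero e hp)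
    (hcurv'.mono fun p hp => hr'.crOp_crSlope_eq_zero e hp)
    (hr.crOp_ofReal hek) (hr'.crOp_ofReal hek) (sideCoord σ j).contDiff (map_zero _) hnonchar
    hslope (hside.mono fun p hp hy => congrArg _ (hp hy))
  exact heq.mono fun p hp => Complex.ofReal_injective hp

end IsGraphFun

end Extension

section GraphHypersurface

variable {N : ℕ} {k : Fin N} {r : (Fin N → ℂ) → ℝ}

theorem exists_realCoordinates (k : Fin N) {l : Fin (2 * N)} :
    ∃ L : (Fin N → ℂ) ≃L[ℝ] (Fin (2 * N) → ℝ), ∀ p, L p l = (p k).im := by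
  let B := Pi.basis fun _ : Fin N => Complex.basisOneI
  let f₀ : ((_ : Fin N) × Fin 2) ≃ Fin (2 * N) := Fintype.equivOfCardEq (by simp [mul_comm])
  let f := f₀.trans (Equiv.swap (f₀ ⟨k, 1⟩) l)
  have hf : f.symm l = ⟨k, 1⟩ := by simp [f]
  refine ⟨(B.reindex f).equivFun.toContinuousLinearEquiv, fun p => ?_⟩
  change (B.reindex f).equivFun p l = _
  rw [Module.Basis.equivFun_apply, Module.Basis.repr_reindex_apply, hf]
  simp [B, Pi.basis_repr]

theorem mem_modelHyperplane_iff {l : Fin (2 * N)} (hl : (l : ℕ) + 1 = 2 * N)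
    {x : Fin (2 * N) → ℝ} : x ∈ modelHyperplane N ↔ x l = 0 :=
  ⟨fun h => h l hl, fun h i hi => by rwa [show i = l from Fin.ext (by omega)]⟩

namespace IsGraphFun

theorem apply_add_smul_imDir (hr : IsGraphFun k r) (p : Fin N → ℂ) (t : ℝ) :
    r (p + t • imDir k) = r p := by
  rw [← hr.flat, flatten_add_smul, hr.flat]

/-- The homeomorphism `p ↦ p - r p • i e_k` flattening the graph of `r` to `Im p_k = 0`. -/
noncomputable def shear (hr : IsGraphFun k r) : (Fin N → ℂ) ≃ₜ (Fin N → ℂ) where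
  toFun p := p + (-r p) • imDir k
  invFun p := p + r p • imDir k
  left_inv p := by simp only [hr.apply_add_smul_imDir]; simp
  right_inv p := by simp only [hr.apply_add_smul_imDir]; simp
  continuous_toFun := by have := hr.smooth.continuous; fun_prop
  continuous_invFun := by have := hr.smooth.continuous; fun_prop

theorem shear_apply_im (hr : IsGraphFun k r) (p : Fin N → ℂ) :
    (hr.shear p k).im = (p k).im - r p := by
  simp [shear, sub_eq_add_neg]

theorem isSmoothHypersurface (hr : IsGraphFun k r) {O : Set (Fin N → ℂ)} (hO : IsOpen O) :
    IsSmoothHypersurface {p | p ∈ O ∧ (p k).im = r p} := by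
  have hN : 0 < N := k.pos
  let l : Fin (2 * N) := ⟨2 * N - 1, by omega⟩
  obtain ⟨L, hL⟩ := exists_realCoordinates k (l := l)
  let φ := (hr.shear.trans L.toHomeomorph).toOpenPartialHomeomorph.restrOpen O hO
  have hsource : φ.source = O := by simp [φ]
  have himage : φ.IsImage {p | p ∈ O ∧ (p k).im = r p} (modelHyperplane N) := fun p hp => by
    have hpl : φ p l = (p k).im - r p := (hL _).trans (hr.shear_apply_im p)
    rw [mem_modelHyperplane_iff (l := l) (by simp only [l]; omega), hpl, sub_eq_zero]
    exact ⟨fun h => ⟨hsource ▸ hp, h⟩, fun h => h.2⟩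
  refine fun p hp => ⟨φ, hsource ▸ hp.1, ⟨?_, ?_⟩, ?_⟩
  · exact (L.contDiff.comp (contDiff_id.add (hr.smooth.neg.smul contDiff_const))).contDiffOn
  · exact ((contDiff_id.add (hr.smooth.smul contDiff_const)).comp L.symm.contDiff).contDiffOn
  · rw [Set.inter_comm, himage.image_eq]

theorem exists_leviFlat_hypersurface (hr : IsGraphFun k r)
    (hcurv : ∀ᶠ p in 𝓝 0, ∀ u v, crCurvature k r u v p = 0) :
    ∃ K, IsSmoothHypersurface K ∧ IsLeviFlat K ∧ ∀ᶠ p in 𝓝 0, (p ∈ K ↔ (p k).im = r p) := by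
  obtain ⟨O, hOcurv, hO, h0O⟩ := eventually_nhds_iff.1 hcurv
  have hmem : ∀ p ∈ O, ∀ᶠ q in 𝓝 p, (q ∈ {q | q ∈ O ∧ (q k).im = r q} ↔ (q k).im = r q) :=
    fun p hp => (hO.eventually_mem hp).mono fun q hq => and_iff_right hq
  exact ⟨_, hr.isSmoothHypersurface hO, hr.isLeviFlat (fun p hp => hmem p hp.1)
    fun p hp => hOcurv p hp.1, hmem 0 h0O⟩

end IsGraphFun

end GraphHypersurface

section DefiningFunctions

variable {N : ℕ}

theorem mem_modelHalf_iff {l m : Fin (2 * N)} (hl : (l : ℕ) + 1 = 2 * N)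
    (hm : (m : ℕ) + 2 = 2 * N) {x : Fin (2 * N) → ℝ} :
    x ∈ modelHalf N ↔ x l = 0 ∧ 0 ≤ x m := by
  refine ⟨fun h => ⟨h.2 l hl, h.1 m hm⟩, fun h => ⟨fun i hi => ?_, fun i hi => ?_⟩⟩
  · rw [show i = m from Fin.ext (by omega)]
    exact h.2
  · rw [show i = l from Fin.ext (by omega)]
    exact h.1

theorem mem_modelEdge_iff {l m : Fin (2 * N)} (hl : (l : ℕ) + 1 = 2 * N)
    (hm : (m : ℕ) + 2 = 2 * N) {x : Fin (2 * N) → ℝ} :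
    x ∈ modelEdge N ↔ x l = 0 ∧ x m = 0 := by
  refine ⟨fun h => ⟨h.2 l hl, h.1 m hm⟩, fun h => ⟨fun i hi => ?_, fun i hi => ?_⟩⟩
  · rw [show i = m from Fin.ext (by omega)]
    exact h.2
  · rw [show i = l from Fin.ext (by omega)]
    exact h.1

theorem mem_iff_of_image_inter_source_eq {α β : Type*} [TopologicalSpace α] [TopologicalSpace β]
    {φ : OpenPartialHomeomorph α β} {S : Set α} {M : Set β}
    (h : φ '' (S ∩ φ.source) = φ.target ∩ M) {p : α} (hp : p ∈ φ.source) : p ∈ S ↔ φ p ∈ M := by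
  have himage : φ p ∈ φ '' (S ∩ φ.source) ↔ p ∈ S := by
    refine ⟨fun ⟨q, ⟨hqS, hq⟩, hqp⟩ => ?_, fun hpS => ⟨p, ⟨hpS, hp⟩, rfl⟩⟩
    rwa [← φ.injOn hq hp hqp]
  rw [← himage, h]
  exact and_iff_right (φ.map_source hp)

theorem IsSmoothChart.exists_coordinates
    {φ : OpenPartialHomeomorph (Fin N → ℂ) (Fin (2 * N) → ℝ)} (hφ : IsSmoothChart φ)
    {p : Fin N → ℂ} (hp : p ∈ φ.source) :
    ∃ f : Fin (2 * N) → (Fin N → ℂ) → ℝ, (∀ i, ContDiff ℝ ∞ (f i)) ∧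
      (∀ᶠ q in 𝓝 p, ∀ i, f i q = φ q i) ∧ LinearIndependent ℝ fun i => fderiv ℝ (f i) p := by
  have hsource : φ.source ∈ 𝓝 p := φ.open_source.mem_nhds hp
  choose f hf hfφ using fun i => exists_contDiff_eventuallyEq hsource
    ((contDiff_apply ℝ ℝ i).comp_contDiffOn hφ.1)
  refine ⟨f, hf, eventually_all.2 hfφ, Fintype.linearIndependent_iff.2 fun c hc i => ?_⟩
  have hd : DifferentiableAt ℝ φ p := (hφ.1.contDiffAt hsource).differentiableAt (by simp)
  have hdsymm : DifferentiableAt ℝ φ.symm (φ p) := (hφ.2.contDiffAt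
    (φ.open_target.mem_nhds (φ.map_source hp))).differentiableAt (by simp)
  have hinv : (fderiv ℝ φ p).comp (fderiv ℝ φ.symm (φ p)) = ContinuousLinearMap.id ℝ _ := by
    have hcomp := HasFDerivAt.comp (φ p) ((φ.left_inv hp).symm ▸ hd.hasFDerivAt) hdsymm.hasFDerivAt
    rw [φ.left_inv hp] at hcomp
    exact hcomp.unique ((hasFDerivAt_id (φ p)).congr_of_eventuallyEq
      (φ.eventually_right_inverse' hp))
  have hfi : ∀ j v, fderiv ℝ (f j) p v = fderiv ℝ φ p v j := fun j v => by
    rw [(hfφ j).fderiv_eq]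
    exact fderiv_apply hd j ▸ rfl
  have hval := congrArg (fun ℓ => ℓ (fderiv ℝ φ.symm (φ p) (Pi.single i 1))) hc
  have hsingle : ∀ j, fderiv ℝ φ p (fderiv ℝ φ.symm (φ p) (Pi.single i 1)) j =
      (Pi.single i 1 : Fin (2 * N) → ℝ) j :=
    fun j => congrFun (DFunLike.congr_fun hinv _) j
  simpa [hfi, hsingle, Pi.single_apply] using hval

theorem IsSmoothHypersurface.exists_definingFunction {K : Set (Fin N → ℂ)}
    (hK : IsSmoothHypersurface K) (hN : 0 < N) {p : Fin N → ℂ} (hp : p ∈ K) :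
    ∃ ρ : (Fin N → ℂ) → ℝ, ContDiff ℝ ∞ ρ ∧ fderiv ℝ ρ p ≠ 0 ∧
      ∀ᶠ q in 𝓝 p, (q ∈ K ↔ ρ q = 0) := by
  obtain ⟨φ, hps, hφ, himage⟩ := hK p hp
  obtain ⟨f, hf, hfφ, hli⟩ := hφ.exists_coordinates hps
  let l : Fin (2 * N) := ⟨2 * N - 1, by omega⟩
  refine ⟨f l, hf l, hli.ne_zero l, ?_⟩
  filter_upwards [hfφ, φ.open_source.mem_nhds hps] with q hq hqs
  rw [mem_iff_of_image_inter_source_eq himage hqs,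
    mem_modelHyperplane_iff (l := l) (by simp only [l]; omega), hq]

/-- A pair of global defining functions, near the origin, for a hypersurface `H` with boundary
`bH`: `H` is `ρ = 0 ≤ g` and `bH` is `ρ = g = 0`. -/
structure IsDefiningPair (H bH : Set (Fin N → ℂ)) (ρ g : (Fin N → ℂ) → ℝ) : Prop where
  contDiff_left : ContDiff ℝ ∞ ρ
  contDiff_right : ContDiff ℝ ∞ g
  linearIndependent : LinearIndependent ℝ ![fderiv ℝ ρ 0, fderiv ℝ g 0]
  mem_iff : ∀ᶠ q in 𝓝 0, (q ∈ H ↔ ρ q = 0 ∧ 0 ≤ g q)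
  mem_boundary_iff : ∀ᶠ q in 𝓝 0, (q ∈ bH ↔ ρ q = 0 ∧ g q = 0)

theorem IsSmoothHypersurfaceWithBoundary.exists_isDefiningPair {H bH : Set (Fin N → ℂ)}
    (hH : IsSmoothHypersurfaceWithBoundary H bH) (hN : 2 ≤ N) (h0 : 0 ∈ bH) :
    ∃ ρ g, IsDefiningPair H bH ρ g := by
  obtain ⟨φ, h0s, hφ, htarget, hhalf, hedge⟩ := hH.boundary_chart 0 h0
  obtain ⟨f, hf, hfφ, hli⟩ := hφ.exists_coordinates h0s
  let l : Fin (2 * N) := ⟨2 * N - 1, by omega⟩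
  let m : Fin (2 * N) := ⟨2 * N - 2, by omega⟩
  have hl : (l : ℕ) + 1 = 2 * N := by simp only [l]; omega
  have hm : (m : ℕ) + 2 = 2 * N := by simp only [m]; omega
  have hlm : l ≠ m := fun h => by have := congrArg Fin.val h; omega
  have hmem {S : Set (Fin N → ℂ)} {M} (h : φ '' (S ∩ φ.source) = M) {q} (hq : q ∈ φ.source) :
      q ∈ S ↔ φ q ∈ M :=
    mem_iff_of_image_inter_source_eq (by rw [h, htarget, Set.univ_inter]) hq
  refine ⟨f l, f m, hf l, hf m, ?_, ?_, ?_⟩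
  · have hpair := hli.comp ![l, m] (List.nodup_ofFn.1 (by simpa using hlm))
    convert hpair using 1
    funext i
    fin_cases i <;> rfl
  · filter_upwards [hfφ, φ.open_source.mem_nhds h0s] with q hq hqs
    rw [hmem hhalf hqs, mem_modelHalf_iff hl hm, hq, hq]
  · filter_upwards [hfφ, φ.open_source.mem_nhds h0s] with q hq hqs
    rw [hmem hedge hqs, mem_modelEdge_iff hl hm, hq, hq]

end DefiningFunctions

section HalfGraph

variable {N : ℕ} {j k : Fin N} {σ : ℝ} {H bH : Set (Fin N → ℂ)} {r ρ g : (Fin N → ℂ) → ℝ}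

theorem fderiv_eq_zero_of_pos {E : Type*} [NormedAddCommGroup E] [NormedSpace ℝ E] {y : E →L[ℝ] ℝ}
    {Y x : E} {f : E → ℝ} (hY : 0 < y Y) (hf : ContDiff ℝ ∞ f)
    (h : ∀ᶠ p in 𝓝 x, 0 < y p → f p = 0) (hx : 0 ≤ y x) : fderiv ℝ f x = 0 := by
  have hderiv : ∀ᶠ p in 𝓝 x, 0 < y p → fderiv ℝ f p = 0 :=
    (eventually_eventuallyEq_of_pos y.continuous h).mono fun p hp hy =>
      (hp hy).fderiv_eq.trans (fderiv_const_apply 0)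
  exact (eventually_eq_zero_of_pos hY (hf.continuous_fderiv (by simp)) hderiv).self_of_nhds hx

theorem eventually_eq_zero_iff_im_eq_zero (hg : ContDiff ℝ ∞ g) (h0 : g 0 = 0)
    (hd : fderiv ℝ g 0 (imDir j) ≠ 0) (hzero : ∀ᶠ p in 𝓝 0, g p = 0 → (p j).im = 0) :
    ∀ᶠ p in 𝓝 0, (g p = 0 ↔ (p j).im = 0) := by
  obtain ⟨s, hs, hs0, hgs⟩ := exists_graph_of_fderiv_ne_zero hg h0 hd
  have hlim := hs.tendsto_graphPt hs0
  filter_upwards [hgs, hzero, hlim.eventually hgs, hlim.eventually hzero] with p hp hz hp' hz'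
  have hsp : s p = 0 := by
    rw [← graphPt_apply_im (k := j) s p]
    exact hz' (hp'.2 (hs.graphPt_mem p))
  exact ⟨hz, fun h => hp.2 (h.trans hsp.symm)⟩

theorem eventually_nonneg_iff_sideCoord (hg : ContDiff ℝ ∞ g) (hσ : σ * σ = 1)
    (hd : 0 < σ * fderiv ℝ g 0 (imDir j)) (hzero : ∀ᶠ p in 𝓝 0, (g p = 0 ↔ (p j).im = 0)) :
    ∀ᶠ p in 𝓝 0, (0 ≤ g p ↔ 0 ≤ sideCoord σ j p) := by
  have hcont : Continuous fun p => σ * fderiv ℝ g p (imDir j) :=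
    continuous_const.mul ((hg.continuous_fderiv (by simp)).clm_apply continuous_const)
  obtain ⟨ε, hε, hpos⟩ := Metric.eventually_nhds_iff_ball.1
    (hcont.continuousAt.eventually (lt_mem_nhds hd))
  have hball := Metric.ball_mem_nhds (0 : Fin N → ℂ) hε
  have hflat : Tendsto (flatten j) (𝓝 0) (𝓝 0) :=
    (flatten j).continuous.tendsto' 0 0 (map_zero _)
  filter_upwards [hball, hflat.eventually hball, hflat.eventually hzero] with p hp hfp hz
  obtain ⟨z, hz', hmvt⟩ := domain_mvt
    (fun q _ => (hg.differentiable (by simp) q).hasFDerivAt.hasFDerivWithinAt)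
    (convex_ball 0 ε) hfp hp
  have hgz := hpos z ((convex_ball 0 ε).segment_subset hfp hp hz')
  have hgp : g p = sideCoord σ j p * (σ * fderiv ℝ g z (imDir j)) := by
    rw [hz.2 (flatten_apply_self_im j p), sub_zero, flatten_apply, sub_sub_cancel, map_smul,
      smul_eq_mul] at hmvt
    rw [hmvt, sideCoord_apply]
    linear_combination -(p j).im * fderiv ℝ g z (imDir j) * hσ
  rw [hgp, mul_nonneg_iff_of_pos_right hgz]

theorem IsGraphFun.fderiv_comp_graphPt (hr : IsGraphFun k r) {f : (Fin N → ℂ) → ℝ} {p : Fin N → ℂ}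
    (hf : DifferentiableAt ℝ f (graphPt k r p)) (v : Fin N → ℂ) :
    fderiv ℝ (f ∘ graphPt k r) p v =
      fderiv ℝ f (graphPt k r p) (flatten k v + fderiv ℝ r p v • imDir k) := by
  rw [(hf.hasFDerivAt.comp p (hasFDerivAt_graphPt (hr.smooth.differentiable (by simp) p))).fderiv]
  rfl

namespace IsDefiningPair

theorem exists_imCoord_eq (h : IsDefiningPair H bH ρ g) (h0 : 0 ∈ bH) {i : Fin N}
    (hi : ∀ p ∈ bH, (p i).im = 0) :
    ∃ s t : ℝ, imCoord i = s • fderiv ℝ ρ 0 + t • fderiv ℝ g 0 := by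
  obtain ⟨hρ0, hg0⟩ := h.mem_boundary_iff.self_of_nhds.1 h0
  have hextr : IsLocalExtrOn (imCoord i) {p | ∀ l, ![ρ, g] l p = ![ρ, g] l 0} 0 := by
    refine .inl (eventually_nhdsWithin_iff.2 (h.mem_boundary_iff.mono fun p hp hps => ?_))
    have hpb : p ∈ bH := hp.2 ⟨(hps 0).trans hρ0, (hps 1).trans hg0⟩
    rw [map_zero, imCoord_apply, hi p hpb]
  obtain ⟨Λ, Λ₀, hΛ, hsum⟩ := hextr.exists_multipliers_of_hasStrictFDerivAt
    (f' := ![fderiv ℝ ρ 0, fderiv ℝ g 0])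
    (Fin.forall_fin_two.2 ⟨h.contDiff_left.contDiffAt.hasStrictFDerivAt (by simp),
      h.contDiff_right.contDiffAt.hasStrictFDerivAt (by simp)⟩) (imCoord i).hasStrictFDerivAt
  have hΛ₀ : Λ₀ ≠ 0 := by
    rintro rfl
    rw [zero_smul, add_zero] at hsum
    exact hΛ (Prod.ext (funext (Fintype.linearIndependent_iff.1 h.linearIndependent Λ hsum)) rfl)
  refine ⟨-(Λ 0 / Λ₀), -(Λ 1 / Λ₀), ?_⟩
  rw [Fin.sum_univ_two] at hsum
  ext v
  have hv : Λ 0 * fderiv ℝ ρ 0 v + Λ 1 * fderiv ℝ g 0 v + Λ₀ * imCoord i v = 0 :=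
    DFunLike.congr_fun hsum v
  change imCoord i v = -(Λ 0 / Λ₀) * fderiv ℝ ρ 0 v + -(Λ 1 / Λ₀) * fderiv ℝ g 0 v
  field_simp
  linear_combination hv

theorem fderiv_imDir_ne_zero_or (h : IsDefiningPair H bH ρ g) (h0 : 0 ∈ bH) (hjk : j ≠ k)
    (hj : ∀ p ∈ bH, (p j).im = 0) (hk : ∀ p ∈ bH, (p k).im = 0) :
    fderiv ℝ ρ 0 (imDir j) ≠ 0 ∨ fderiv ℝ ρ 0 (imDir k) ≠ 0 := by
  by_contra! hρ
  obtain ⟨s, t, hst⟩ := h.exists_imCoord_eq h0 hj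
  obtain ⟨s', t', hst'⟩ := h.exists_imCoord_eq h0 hk
  have hjj : t * fderiv ℝ g 0 (imDir j) = 1 := by
    simpa [imCoord_apply, hρ.1] using (DFunLike.congr_fun hst (imDir j)).symm
  have hkj : t' * fderiv ℝ g 0 (imDir j) = 0 := by
    simpa [imCoord_apply, hρ.1, hjk.symm] using DFunLike.congr_fun hst' (imDir j)
  have hkk : t' * fderiv ℝ g 0 (imDir k) = 1 := by
    simpa [imCoord_apply, hρ.2] using (DFunLike.congr_fun hst' (imDir k)).symm
  exact mul_ne_zero (left_ne_zero_of_mul_eq_one hkk) (right_ne_zero_of_mul_eq_one hjj) hkj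

theorem fderiv_comp_graphPt_ne_zero (h : IsDefiningPair H bH ρ g) (h0 : 0 ∈ bH) (hjk : j ≠ k)
    (hj : ∀ p ∈ bH, (p j).im = 0) (hr : IsGraphFun k r) (hr0 : r 0 = 0)
    (hρr : ∀ᶠ p in 𝓝 0, ρ (graphPt k r p) = 0) :
    fderiv ℝ (g ∘ graphPt k r) 0 (imDir j) ≠ 0 := by
  obtain ⟨s, t, hst⟩ := h.exists_imCoord_eq h0 hj
  set w : Fin N → ℂ := flatten k (imDir j) + fderiv ℝ r 0 (imDir j) • imDir k
  have hcomp {f : (Fin N → ℂ) → ℝ} (hf : ContDiff ℝ ∞ f) :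
      fderiv ℝ (f ∘ graphPt k r) 0 (imDir j) = fderiv ℝ f 0 w := by
    rw [hr.fderiv_comp_graphPt (hf.differentiable (by simp) _), graphPt_zero hr0]
  have hρw : fderiv ℝ ρ 0 w = 0 := by
    rw [← hcomp h.contDiff_left, (show ρ ∘ graphPt k r =ᶠ[𝓝 0] 0 from hρr).fderiv_eq,
      fderiv_zero, Pi.zero_apply, zero_apply]
  have himw : imCoord j w = 1 := by
    simp [w, imCoord_apply, flatten_apply_of_ne k _ hjk, hjk]
  have htw : t * fderiv ℝ g 0 w = 1 := by
    simpa [hst, hρw] using himw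
  rw [hcomp h.contDiff_right]
  exact right_ne_zero_of_mul_eq_one htw

end IsDefiningPair

/-- Near the origin, `H` is the part of the graph `Im p_k = r p` with `σ Im p_j ≥ 0`, and `bH` is
the part with `Im p_j = 0`, where moreover `r` vanishes; `σ` is a sign. -/
structure IsHalfGraph (H bH : Set (Fin N → ℂ)) (j k : Fin N) (σ : ℝ) (r : (Fin N → ℂ) → ℝ) :
    Prop where
  ne : j ≠ k
  sign : σ * σ = 1
  isGraphFun : IsGraphFun k r
  apply_zero : r 0 = 0
  mem_iff : ∀ᶠ p in 𝓝 0, (p ∈ H ↔ (p k).im = r p ∧ 0 ≤ sideCoord σ j p)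
  mem_boundary_iff : ∀ᶠ p in 𝓝 0, (p ∈ bH ↔ (p k).im = r p ∧ sideCoord σ j p = 0)
  edge : ∀ᶠ p in 𝓝 0, sideCoord σ j p = 0 → r p = 0

theorem IsDefiningPair.exists_isHalfGraph (h : IsDefiningPair H bH ρ g) (h0 : 0 ∈ bH) (hjk : j ≠ k)
    (hj : ∀ p ∈ bH, (p j).im = 0) (hk : ∀ p ∈ bH, (p k).im = 0)
    (hd : fderiv ℝ ρ 0 (imDir k) ≠ 0) : ∃ σ r, IsHalfGraph H bH j k σ r := by
  obtain ⟨hρ0, hg0⟩ := h.mem_boundary_iff.self_of_nhds.1 h0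
  obtain ⟨r, hr, hr0, hρr⟩ := exists_graph_of_fderiv_ne_zero h.contDiff_left hρ0 hd
  have hlim := hr.tendsto_graphPt hr0
  have hρgraph : ∀ᶠ p in 𝓝 0, ρ (graphPt k r p) = 0 :=
    (hlim.eventually hρr).mono fun p hp => hp.2 (hr.graphPt_mem p)
  have hboundary : ∀ᶠ p in 𝓝 0, g (graphPt k r p) = 0 → graphPt k r p ∈ bH := by
    filter_upwards [hlim.eventually h.mem_boundary_iff, hρgraph] with p hb hρp hgp
    exact hb.2 ⟨hρp, hgp⟩
  have hG : ContDiff ℝ ∞ (g ∘ graphPt k r) := h.contDiff_right.comp hr.contDiff_graphPt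
  have hGj := h.fderiv_comp_graphPt_ne_zero h0 hjk hj hr hr0 hρgraph
  have hzero := eventually_eq_zero_iff_im_eq_zero hG
    ((congrArg g (graphPt_zero hr0)).trans hg0) hGj
    (hboundary.mono fun p hp hgp => graphPt_apply_of_ne r p hjk ▸ hj _ (hp hgp))
  obtain ⟨σ, hσ, hpos⟩ : ∃ σ : ℝ, σ * σ = 1 ∧ 0 < σ * fderiv ℝ (g ∘ graphPt k r) 0 (imDir j) := by
    rcases hGj.lt_or_gt with hneg | hpos
    · exact ⟨-1, by norm_num, by linarith⟩
    · exact ⟨1, by norm_num, by linarith⟩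
  have hside : ∀ p, (sideCoord σ j p = 0 ↔ (p j).im = 0) := fun p => by
    rw [sideCoord_apply, mul_eq_zero, or_iff_right (left_ne_zero_of_mul_eq_one hσ)]
  refine ⟨σ, r, hjk, hσ, hr, hr0, ?_, ?_, ?_⟩
  · filter_upwards [h.mem_iff, hρr, eventually_nonneg_iff_sideCoord hG hσ hpos hzero]
      with p hp hρp hgp
    rw [hp, hρp, ← hgp]
    exact and_congr_right fun hpr => by rw [Function.comp_apply, graphPt_eq_self hpr]
  · filter_upwards [h.mem_boundary_iff, hρr, hzero] with p hp hρp hgp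
    rw [hp, hρp, hside, ← hgp]
    exact and_congr_right fun hpr => by rw [Function.comp_apply, graphPt_eq_self hpr]
  · filter_upwards [hboundary, hzero] with p hp hgp hy
    rw [← graphPt_apply_im (k := k) r p]
    exact hk _ (hp (hgp.2 ((hside p).1 hy)))

theorem IsSmoothHypersurfaceWithBoundary.exists_isHalfGraph
    (hH : IsSmoothHypersurfaceWithBoundary H bH) (hN : 2 ≤ N) (h0 : 0 ∈ bH)
    (hb : bH ⊆ flatModel N) : ∃ j k σ r, IsHalfGraph H bH j k σ r := by
  obtain ⟨ρ, g, h⟩ := hH.exists_isDefiningPair hN h0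
  let a : Fin N := ⟨N - 2, by omega⟩
  let b : Fin N := ⟨N - 1, by omega⟩
  have ha : ∀ p ∈ bH, (p a).im = 0 := fun p hp => hb hp a (by simp only [a]; omega)
  have hb : ∀ p ∈ bH, (p b).im = 0 := fun p hp => hb hp b (by simp only [b]; omega)
  have hab : a ≠ b := fun h => by have := congrArg Fin.val h; simp only [a, b] at this; omega
  rcases h.fderiv_imDir_ne_zero_or h0 hab ha hb with hd | hd
  · exact ⟨b, a, h.exists_isHalfGraph h0 hab.symm hb ha hd⟩
  · exact ⟨a, b, h.exists_isHalfGraph h0 hab ha hb hd⟩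

namespace IsHalfGraph

theorem eventually_crCurvature_eq_zero (h : IsHalfGraph H bH j k σ r)
    (hflat : IsLeviFlat (H \ bH)) :
    ∀ᶠ p in 𝓝 0, 0 < sideCoord σ j p → ∀ u v, crCurvature k r u v p = 0 := by
  have hcurv := h.isGraphFun.eventually_crCurvature_eq_zero h.apply_zero hflat
    (isOpen_lt continuous_const (sideCoord σ j).continuous) (by
      filter_upwards [h.mem_iff, h.mem_boundary_iff] with p hp hb (hy : 0 < sideCoord σ j p)
      rw [Set.mem_sdiff, hp, hb]
      exact ⟨fun hmem => hmem.1.1, fun hmem => ⟨⟨hmem, hy.le⟩, fun hzero => hy.ne' hzero.2⟩⟩)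
  filter_upwards [hcurv] with p hp hy
  exact hp ((sideCoord_graphPt h.ne p).symm ▸ hy)

theorem exists_graph_of_subset (h : IsHalfGraph H bH j k σ r) {K : Set (Fin N → ℂ)}
    (hK : IsSmoothHypersurface K) (hsub : ∀ᶠ p in 𝓝 0, p ∈ H → p ∈ K) :
    ∃ r', IsGraphFun k r' ∧ r' 0 = 0 ∧ (∀ᶠ p in 𝓝 0, (p ∈ K ↔ (p k).im = r' p)) ∧
      ∀ᶠ p in 𝓝 0, 0 ≤ sideCoord σ j p → r p = r' p := by
  have hr := h.isGraphFun
  have hlim := hr.tendsto_graphPt h.apply_zero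
  have hgraph : ∀ᶠ p in 𝓝 0, 0 ≤ sideCoord σ j p → graphPt k r p ∈ K := by
    filter_upwards [hlim.eventually h.mem_iff, hlim.eventually hsub] with p hp hs hy
    exact hs (hp.2 ⟨hr.graphPt_mem p, by rwa [sideCoord_graphPt h.ne]⟩)
  have h0K : 0 ∈ K := by
    simpa only [graphPt_zero h.apply_zero] using hgraph.self_of_nhds (map_zero _).ge
  obtain ⟨ρ, hρ, hd, hKρ⟩ := hK.exists_definingFunction k.pos h0K
  have hcomp : fderiv ℝ (ρ ∘ graphPt k r) 0 = 0 := by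
    refine fderiv_eq_zero_of_pos (sideCoord_I_smul h.sign ▸ one_pos)
      (hρ.comp hr.contDiff_graphPt) ?_ (map_zero (sideCoord σ j)).ge
    filter_upwards [hgraph, hlim.eventually hKρ] with p hp hpρ hy
    exact hpρ.1 (hp hy.le)
  have hk : fderiv ℝ ρ 0 (imDir k) ≠ 0 := by
    refine fun hk => hd (ContinuousLinearMap.ext fun v => ?_)
    have hv := hr.fderiv_comp_graphPt (hρ.differentiable (by simp) (graphPt k r 0)) v
    rw [hcomp, graphPt_zero h.apply_zero, map_add, map_smul, hk, smul_zero, add_zero, flatten_apply,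
      map_sub, map_smul, hk, smul_zero, sub_zero] at hv
    exact hv.symm
  obtain ⟨r', hr', hr0', hρr'⟩ := exists_graph_of_fderiv_ne_zero hρ (hKρ.self_of_nhds.1 h0K) hk
  have hKr' : ∀ᶠ p in 𝓝 0, (p ∈ K ↔ (p k).im = r' p) :=
    (hKρ.and hρr').mono fun p hp => hp.1.trans hp.2
  refine ⟨r', hr', hr0', hKr', ?_⟩
  filter_upwards [hgraph, hlim.eventually hKr'] with p hp hpK hy
  rw [← graphPt_apply_im (k := k) r p, hpK.1 (hp hy), hr'.apply_graphPt]

end IsHalfGraph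

end HalfGraph

theorem theorem1p2 (N : ℕ) (hN : 2 ≤ N) (H bH : Set (Fin N → ℂ))
    (hH : IsSmoothHypersurfaceWithBoundary H bH) (hflat : IsLeviFlat (H \ bH))
    (h0 : (0 : Fin N → ℂ) ∈ bH) (hb : bH ⊆ flatModel N) :
    ∃ U ∈ 𝓝 (0 : Fin N → ℂ), ∃ K : Set (Fin N → ℂ),
      IsSmoothHypersurface K ∧ IsLeviFlat K ∧ H ∩ U ⊆ K ∧
      ∀ K' : Set (Fin N → ℂ), IsSmoothHypersurface K' → IsLeviFlat K' →
        (∃ V ∈ 𝓝 (0 : Fin N → ℂ), H ∩ V ⊆ K') →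
        ∃ W ∈ 𝓝 (0 : Fin N → ℂ), K' ∩ W = K ∩ W := by
  obtain ⟨j, k, σ, r, h⟩ := hH.exists_isHalfGraph hN h0 hb
  obtain ⟨R, hR, hRr, hcurv⟩ := h.isGraphFun.exists_leviFlat_extension h.ne h.sign h.edge
    (h.eventually_crCurvature_eq_zero hflat)
  obtain ⟨K, hK, hKflat, hKR⟩ := hR.exists_leviFlat_hypersurface hcurv
  have hHK : ∀ᶠ p in 𝓝 0, p ∈ H → p ∈ K := by
    filter_upwards [h.mem_iff, hRr, hKR] with p hp hRp hpK hpH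
    exact hpK.2 ((hp.1 hpH).1.trans (hRp (hp.1 hpH).2).symm)
  refine ⟨_, hHK, K, hK, hKflat, fun p hp => hp.2 hp.1, ?_⟩
  rintro K' hK' hflat' ⟨V, hV, hHV⟩
  obtain ⟨r', hr', hr'0, hK'r', hrr'⟩ := h.exists_graph_of_subset hK'
    (mem_of_superset hV fun p hp hpH => hHV ⟨hpH, hp⟩)
  have hcurv' : ∀ᶠ p in 𝓝 0, ∀ u v, crCurvature k r' u v p = 0 :=
    (hr'.eventually_crCurvature_eq_zero hr'0 hflat' isOpen_univ
      (hK'r'.mono fun p hp _ => hp)).mono fun p hp => hp trivial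
  have hRr' : ∀ᶠ p in 𝓝 0, R p = r' p :=
    hR.eventually_eq_of_crCurvature hr' h.ne h.sign hcurv hcurv'
      ((hRr.and hrr').mono fun p hp hy => (hp.1 hy).trans (hp.2 hy))
  refine ⟨{p | p ∈ K' ↔ p ∈ K}, ?_, Set.ext fun p => and_congr_left Iff.rfl.mp⟩
  filter_upwards [hRr', hK'r', hKR] with p hp hpK' hpK
  exact (hp ▸ hpK').trans hpK.symm
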